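/- **Partial recovery from a regularized adjacency matrix.** For every $\varepsilon>0$ and $r\ge 1$ there is a constant $C>0$, depending only on $\varepsilon$ and $r$, such that the following holds. Let $n$ be a natural number and $0\le b<a\le n$ real numbers with $$(a-b)^2 > C(a+b).$$ Let the vertex set $\{1,\dots,n\}$ be split into two communities of $n/2$ vertices each, and let $A$ be the adjacency matrix of a random simple graph drawn from the stochastic block model $G(n,\frac an,\frac bn)$: distinct vertices are joined independently, with probability $a/n$ if they lie in the same community and $b/n$ if they lie in different communities. Then with probability at least $1-e^{-r}$ the following holds for every symmetric matrix $A'$ that arises from $A$ by reducing, in an arbitrary way (keeping them nonnegative), the weights of the edges incident to vertices of degree larger than $2a$ so that all degrees (row sums) of the new weighted graph are at most $2a$, all other edges keeping their weights. Let $\lambda_1\ge\lambda_2\ge\dots\ge\lambda_n$ be the eigenvalues of $A'$, and let $v_2$ be any eigenvector of $A'$ for the second largest eigenvalue $\lambda_2$ (in the degenerate case $\lambda_1=\lambda_2$, any such eigenvector orthogonal to some nonzero entrywise nonnegative eigenvector for $\lambda_1$). Then the signs of the entries of $v_2$ correctly estimate the partition into the two communities, up to at most $\varepsilon n$ misclassified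 vertices: one can assign to the two communities two distinct signs from $\{+,0,-\}$ such that all but at most $\varepsilon n$ vertices $i$ are such that $v_2(i)$ has the sign assigned to the community of $i$. -/

import Mathlib

open MeasureTheory ProbabilityTheory

/-- `c` splits the vertex set into two communities of equal size. -/
def IsBalanced {n : ℕ} (c : Fin n → Bool) : Prop :=
  {i | c i = true}.ncard = {i | c i = false}.ncard

/-- `G` is a random simple graph (no loops) on `Fin n` with independent edges, defined on the
probability space `(Ω, μ)`: two distinct vertices are joined with probability `p` if they lie in
the same community of `c`, and with probability `q` otherwise. -/
structure IsPlantedPartitionGraph {Ω : Type*} [MeasurableSpace Ω] (μ : Measure Ω) {n : ℕ}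
    (c : Fin n → Bool) (p q : ℝ) (G : Ω → SimpleGraph (Fin n)) : Prop where
  measurableSet_adj : ∀ i j, MeasurableSet {ω | (G ω).Adj i j}
  prob_adj : ∀ i j, i ≠ j →
    μ {ω | (G ω).Adj i j} = ENNReal.ofReal (if c i = c j then p else q)
  indep : iIndepSet
    (fun e : {e : Fin n × Fin n // e.1 < e.2} => {ω | (G ω).Adj e.1.1 e.1.2}) μ

open Classical in
/-- The 0-1 adjacency matrix of `G`. -/
noncomputable def adjacency {n : ℕ} (G : SimpleGraph (Fin n)) : Matrix (Fin n) (Fin n) ℝ :=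
  G.adjMatrix ℝ

/-- The degree of the vertex `i` in the weighted graph with adjacency matrix `M`. -/
def weightedDegree {n : ℕ} (M : Matrix (Fin n) (Fin n) ℝ) (i : Fin n) : ℝ :=
  ∑ j, M i j

/-- `A'` arises from `A` by reducing in some way (keeping them nonnegative and the matrix
symmetric) the weights of the edges incident to vertices of degree larger than `t`, so that all
degrees of the new weighted graph are at most `t`. Edges between two vertices of degree
at most `t` keep their weights. -/
structure IsDegreeRegularization {n : ℕ} (A : Matrix (Fin n) (Fin n) ℝ) (t : ℝ)
    (A' : Matrix (Fin n) (Fin n) ℝ) : Prop where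
  symm : A'.IsSymm
  nonneg : ∀ i j, 0 ≤ A' i j
  le : ∀ i j, A' i j ≤ A i j
  eq_of_degree_le : ∀ i j, weightedDegree A i ≤ t → weightedDegree A j ≤ t → A' i j = A i j
  degree_le : ∀ i, weightedDegree A' i ≤ t

/-- `v` is an eigenvector of the symmetric matrix `M` for its second largest eigenvalue `λ₂`,
where `λ₁ ≥ λ₂ ≥ ⋯` are the eigenvalues of `M` counted with multiplicity.
Only in the degenerate case `λ₁ = λ₂`, where the eigenspace of `λ₂` contains that of the largest
eigenvalue, it is moreover required that `v` is orthogonal to a leading eigenvector with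
nonnegative entries. If `λ₁ > λ₂`, then `v` is any eigenvector for `λ₂`. -/
def IsSecondEigenvector {n : ℕ} (M : Matrix (Fin n) (Fin n) ℝ) (v : Fin n → ℝ) : Prop :=
  ∃ (hM : M.IsHermitian) (k₁ k₂ : Fin (Fintype.card (Fin n))),
    (k₁ : ℕ) = 0 ∧ (k₂ : ℕ) = 1 ∧
    v ≠ 0 ∧ M.mulVec v = hM.eigenvalues₀ k₂ • v ∧
    (hM.eigenvalues₀ k₁ = hM.eigenvalues₀ k₂ →
      ∃ u : Fin n → ℝ, u ≠ 0 ∧ (∀ i, 0 ≤ u i) ∧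
        M.mulVec u = hM.eigenvalues₀ k₁ • u ∧ dotProduct u v = 0)

/-- The signs of the entries of `v` determine the communities of `c`, up to a permutation of the
two labels and up to at most `m` misclassified vertices: there are two distinct signs, one for each
community, and all but at most `m` vertices `i` are such that `v i` has the sign of the community
of `i`. -/
def SignsRecover {n : ℕ} (c : Fin n → Bool) (v : Fin n → ℝ) (m : ℝ) : Prop :=
  ∃ α β : SignType, α ≠ β ∧
    ({i | SignType.sign (v i) ≠ if c i = true then α else β}.ncard : ℝ) ≤ m

/-!
Let `M` be the matrix with entries `a / n` within the communities and `b / n` across them. The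
proof compares the regularized matrix `A'` with `M` in operator norm, following Kahn–Szemerédi and
Feige–Ofek. The norm of a symmetric matrix is controlled by its quadratic form at integer vectors
`z` with `∑ zᵢ² ≤ 16 n`, of which there are only exponentially many. Light pairs, those with
`|zᵢ zⱼ| ≤ 2 √a`, obey a Chernoff bound for each `z` and hence for all `z` at once. Heavy pairs are
controlled by the numbers of edges between sets of vertices: on dyadic level sets of `z`, a
discrepancy property and the bound `2 a` on the degrees of `A'` sum up to `O(n √a)`. Few vertices
have degree above `2 a`, so that the weights removed from light pairs contribute only `O(n √a)` as
well. Hence `‖A' - M‖ = O(√a)`, which the hypothesis makes small compared to `a - b`.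

Both `v₂` and a nonnegative leading eigenvector `u` then lie close to the span of the two community
indicators, and they are orthogonal. If the mean of `v₂` on each community is bounded away from
zero, the two means have opposite signs. Otherwise `u` is concentrated on one community and `v₂` on
the other, which happens only if `b` is small, and `v₂` may have signs not determined by the
perturbation bound on the community of `u`. Testing the eigenvalue equation against the negative
part of `v₂` shows that either `v₂` is negative on most of that community or `v₂` is nonnegative
everywhere; in the latter case orthogonality to `u` forces it to vanish on most of it. This is why
the sign `0` has to be allowed.
-/

open Finset Real

section Adjacency

variable {n : ℕ} (H : SimpleGraph (Fin n)) (i j : Fin n)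

theorem isSymm_adjacency : (adjacency H).IsSymm := by
  classical
  exact H.isSymm_adjMatrix

theorem adjacency_self : adjacency H i i = 0 := by
  simp [adjacency]

theorem adjacency_mem_Icc : adjacency H i j ∈ Set.Icc (0 : ℝ) 1 := by
  simp only [adjacency, SimpleGraph.adjMatrix_apply]
  split_ifs <;> simp

theorem adjacency_eq_indicator {Ω : Type*} (G : Ω → SimpleGraph (Fin n)) (ω : Ω) :
    adjacency (G ω) i j = Set.indicator {ω | (G ω).Adj i j} 1 ω := by
  by_cases h : (G ω).Adj i j <;> simp [adjacency, h]

end Adjacency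

theorem sum_sum_eq_sum_lt_add {ι M : Type*} [Fintype ι] [LinearOrder ι] [AddCommMonoid M]
    (f : ι → ι → M) (hf : ∀ i, f i i = 0) :
    ∑ i, ∑ j, f i j = ∑ e : {e : ι × ι // e.1 < e.2}, (f e.1.1 e.1.2 + f e.1.2 e.1.1) := by
  have hswap : ∑ e : ι × ι with e.1 < e.2, f e.2 e.1 = ∑ e : ι × ι with e.2 < e.1, f e.1 e.2 := by
    refine sum_nbij' Prod.swap Prod.swap ?_ ?_ ?_ ?_ ?_ <;> simp
  rw [← sum_product', univ_product_univ,
    ← sum_subtype (univ.filter fun e : ι × ι => e.1 < e.2) (by simp)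
      (fun e => f e.1 e.2 + f e.2 e.1),
    sum_add_distrib, hswap, sum_filter, sum_filter, ← sum_add_distrib]
  refine sum_congr rfl fun ⟨i, j⟩ _ => ?_
  rcases lt_trichotomy i j with h | rfl | h
  · simp [h, h.not_gt]
  · simp [hf]
  · simp [h, h.not_gt]

theorem exp_add_le_add_exp_two_mul (x y : ℝ) :
    exp (x + y) ≤ (exp (2 * x) + exp (2 * y)) / 2 := by
  rw [exp_add, two_mul x, two_mul y, exp_add, exp_add]
  linarith [two_mul_le_add_sq (exp x) (exp y), sq (exp x), sq (exp y)]

section IndependentEdges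

variable {Ω : Type*} [MeasurableSpace Ω] {μ : Measure Ω} {n : ℕ} {G : Ω → SimpleGraph (Fin n)}

/-- The edges of the random graph `G` are independent events, with arbitrary probabilities. -/
structure HasIndependentEdges (μ : Measure Ω) (G : Ω → SimpleGraph (Fin n)) : Prop where
  measurableSet_adj : ∀ i j, MeasurableSet {ω | (G ω).Adj i j}
  iIndepSet_adj : iIndepSet
    (fun e : {e : Fin n × Fin n // e.1 < e.2} => {ω | (G ω).Adj e.1.1 e.1.2}) μ

/-- The matrix of edge probabilities of a random graph, which is the expectation of its adjacency
matrix. -/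
noncomputable def edgeProbability (μ : Measure Ω) (G : Ω → SimpleGraph (Fin n)) :
    Matrix (Fin n) (Fin n) ℝ :=
  fun i j => μ.real {ω | (G ω).Adj i j}

theorem edgeProbability_nonneg (i j : Fin n) : 0 ≤ edgeProbability μ G i j :=
  measureReal_nonneg

theorem edgeProbability_self (i : Fin n) : edgeProbability μ G i i = 0 := by
  simp [edgeProbability]

theorem isSymm_edgeProbability : (edgeProbability μ G).IsSymm := by
  ext i j
  simp only [Matrix.transpose_apply, edgeProbability, SimpleGraph.adj_comm]

namespace HasIndependentEdges

variable (hG : HasIndependentEdges μ G)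
include hG

theorem measurable_adjacency (i j : Fin n) : Measurable fun ω => adjacency (G ω) i j := by
  simp only [adjacency_eq_indicator]
  exact measurable_one.indicator (hG.measurableSet_adj i j)

theorem iIndepFun_mul_adjacency (w : {e : Fin n × Fin n // e.1 < e.2} → ℝ) :
    iIndepFun (fun e ω => w e * adjacency (G ω) e.1.1 e.1.2) μ := by
  have h := (hG.iIndepSet_adj.iIndepFun_indicator (β := ℝ) (m := inferInstance)).comp
    (fun e x => w e * x) fun e => measurable_const_mul (w e)
  convert h using 1
  ext e ω
  rw [adjacency_eq_indicator]
  rfl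

variable [IsProbabilityMeasure μ]

theorem mgf_mul_adjacency (i j : Fin n) (w : ℝ) :
    mgf (fun ω => w * adjacency (G ω) i j) μ 1 = 1 + edgeProbability μ G i j * (exp w - 1) := by
  have hexp (ω : Ω) : exp (1 * (w * adjacency (G ω) i j)) =
      1 + Set.indicator {ω | (G ω).Adj i j} (fun _ => exp w - 1) ω := by
    rw [adjacency_eq_indicator]
    by_cases h : (G ω).Adj i j <;> simp [h]
  have hm := hG.measurableSet_adj i j
  simp only [mgf, hexp]
  rw [integral_add (integrable_const _) ((integrable_const _).indicator hm),
    integral_indicator_const _ hm]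
  simp [edgeProbability]

theorem integrable_exp_sum_mul_adjacency (w : Fin n → Fin n → ℝ) (t : ℝ) :
    Integrable (fun ω => exp (t * ∑ i, ∑ j, w i j * adjacency (G ω) i j)) μ := by
  refine integrable_exp_mul_of_mem_Icc (a := -∑ i, ∑ j, |w i j|) (b := ∑ i, ∑ j, |w i j|)
    (measurable_fun_sum _ fun i _ => measurable_fun_sum _ fun j _ =>
      (hG.measurable_adjacency i j).const_mul _).aemeasurable (ae_of_all _ fun ω => ?_)
  refine abs_le.1 ((abs_sum_le_sum_abs _ _).trans (sum_le_sum fun i _ =>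
    (abs_sum_le_sum_abs _ _).trans (sum_le_sum fun j _ => ?_)))
  obtain ⟨h0, h1⟩ := adjacency_mem_Icc (G ω) i j
  rw [abs_mul, abs_of_nonneg h0]
  exact mul_le_of_le_one_right (abs_nonneg _) h1

/-- The factor `2` in the exponent comes from decoupling the two entries of `w` that multiply
the same edge. -/
theorem mgf_sum_mul_adjacency_le (w : Fin n → Fin n → ℝ) :
    mgf (fun ω => ∑ i, ∑ j, w i j * adjacency (G ω) i j) μ 1 ≤
      exp (∑ i, ∑ j, edgeProbability μ G i j * ((exp (2 * w i j) - 1) / 2)) := by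
  set P := edgeProbability μ G
  let v : {e : Fin n × Fin n // e.1 < e.2} → ℝ := fun e => w e.1.1 e.1.2 + w e.1.2 e.1.1
  have hsum : (fun ω => ∑ i, ∑ j, w i j * adjacency (G ω) i j) =
      ∑ e, fun ω => v e * adjacency (G ω) e.1.1 e.1.2 := by
    ext ω
    rw [sum_sum_eq_sum_lt_add _ (by simp [adjacency_self]), Finset.sum_apply]
    refine sum_congr rfl fun e _ => ?_
    rw [(isSymm_adjacency (G ω)).apply e.1.1 e.1.2, ← add_mul]
  have hfactor (e) : mgf (fun ω => v e * adjacency (G ω) e.1.1 e.1.2) μ 1 ≤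
      exp (P e.1.1 e.1.2 * (exp (v e) - 1)) := by
    rw [hG.mgf_mul_adjacency, add_comm]
    exact add_one_le_exp _
  rw [hsum, (hG.iIndepFun_mul_adjacency v).mgf_sum
    fun e => (hG.measurable_adjacency _ _).const_mul _]
  refine (prod_le_prod (fun e _ => mgf_nonneg) fun e _ => hfactor e).trans ?_
  rw [← exp_sum, exp_le_exp, sum_sum_eq_sum_lt_add _ (by simp [P, edgeProbability_self])]
  refine sum_le_sum fun e _ => ?_
  rw [show P e.1.2 e.1.1 = P e.1.1 e.1.2 from isSymm_edgeProbability.apply _ _, ← mul_add]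
  refine mul_le_mul_of_nonneg_left ?_ (edgeProbability_nonneg _ _)
  linarith [exp_add_le_add_exp_two_mul (w e.1.1 e.1.2) (w e.1.2 e.1.1)]

/-- Chernoff's bound at parameter `1`: the quadratic estimate of the exponential holds because the
weights are small. -/
theorem measureReal_le_sum_mul_sub_le {p : ℝ} (hp : ∀ i j, edgeProbability μ G i j ≤ p)
    (w : Fin n → Fin n → ℝ) (hw : ∀ i j, |2 * w i j| ≤ 1) (t : ℝ) :
    μ.real {ω | t ≤ ∑ i, ∑ j, w i j * (adjacency (G ω) - edgeProbability μ G) i j} ≤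
      exp (p * (2 * ∑ i, ∑ j, w i j ^ 2) - t) := by
  set P := edgeProbability μ G
  have hquad (i j) : P i j * ((exp (2 * w i j) - 1) / 2 - w i j) ≤ p * (2 * w i j ^ 2) := by
    have h := (abs_le.1 (abs_exp_sub_one_sub_id_le (hw i j))).2
    refine mul_le_mul (hp i j) (by linarith) ?_ ((edgeProbability_nonneg i j).trans (hp i j))
    linarith [add_one_le_exp (2 * w i j)]
  have hset : {ω | t ≤ ∑ i, ∑ j, w i j * (adjacency (G ω) - P) i j} =
      {ω | t + ∑ i, ∑ j, w i j * P i j ≤ ∑ i, ∑ j, w i j * adjacency (G ω) i j} := by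
    ext ω
    simp only [Set.mem_ofPred_eq, Matrix.sub_apply, mul_sub, sum_sub_distrib, le_sub_iff_add_le]
  rw [hset]
  refine (measure_ge_le_exp_mul_mgf _ zero_le_one
    (hG.integrable_exp_sum_mul_adjacency w 1)).trans ?_
  refine (mul_le_mul_of_nonneg_left (hG.mgf_sum_mul_adjacency_le w) (exp_pos _).le).trans ?_
  rw [← exp_add, exp_le_exp]
  have hsum := sum_le_sum fun i (_ : i ∈ univ) => sum_le_sum fun j (_ : j ∈ univ) => hquad i j
  simp only [mul_sub, sum_sub_distrib, ← mul_sum, mul_comm (P _ _) (w _ _)] at hsum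
  linarith

end HasIndependentEdges

theorem sum_sum_ite_mem_mul {ι κ R : Type*} [Fintype ι] [Fintype κ] [DecidableEq ι]
    [DecidableEq κ] [NonUnitalNonAssocSemiring R] (S : Finset ι) (T : Finset κ) (θ : R)
    (M : Matrix ι κ R) :
    ∑ i, ∑ j, (if i ∈ S ∧ j ∈ T then θ else 0) * M i j = θ * ∑ i ∈ S, ∑ j ∈ T, M i j := by
  simp [ite_and, mul_sum]

namespace HasIndependentEdges

variable [IsProbabilityMeasure μ] (hG : HasIndependentEdges μ G)
include hG

theorem integrable_exp_mul_sum_adjacency (θ : ℝ) (S T : Finset (Fin n)) :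
    Integrable (fun ω => exp (θ * ∑ i ∈ S, ∑ j ∈ T, adjacency (G ω) i j)) μ := by
  have h := hG.integrable_exp_sum_mul_adjacency (fun i j => if i ∈ S ∧ j ∈ T then 1 else 0) θ
  simpa only [sum_sum_ite_mem_mul, one_mul] using h

theorem mgf_sum_adjacency_le {p : ℝ} (hp : ∀ i j, edgeProbability μ G i j ≤ p) {θ : ℝ}
    (hθ : 0 ≤ θ) (S T : Finset (Fin n)) :
    mgf (fun ω => ∑ i ∈ S, ∑ j ∈ T, adjacency (G ω) i j) μ θ ≤
      exp (p * #S * #T * ((exp (2 * θ) - 1) / 2)) := by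
  set P := edgeProbability μ G
  let w : Fin n → Fin n → ℝ := fun i j => if i ∈ S ∧ j ∈ T then θ else 0
  have hexp (i j) : P i j * ((exp (2 * w i j) - 1) / 2) =
      (if i ∈ S ∧ j ∈ T then (exp (2 * θ) - 1) / 2 else 0) * P i j := by
    simp only [w]
    split_ifs
    · exact mul_comm _ _
    · simp
  have hP : ∑ i ∈ S, ∑ j ∈ T, P i j ≤ p * #S * #T :=
    calc ∑ i ∈ S, ∑ j ∈ T, P i j ≤ ∑ _i ∈ S, ∑ _j ∈ T, p :=
          sum_le_sum fun i _ => sum_le_sum fun j _ => hp i j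
      _ = p * #S * #T := by simp; ring
  calc mgf (fun ω => ∑ i ∈ S, ∑ j ∈ T, adjacency (G ω) i j) μ θ
      = mgf (fun ω => ∑ i, ∑ j, w i j * adjacency (G ω) i j) μ 1 := by
        simp only [mgf, w, sum_sum_ite_mem_mul, one_mul]
    _ ≤ exp (∑ i, ∑ j, P i j * ((exp (2 * w i j) - 1) / 2)) := hG.mgf_sum_mul_adjacency_le w
    _ = exp ((exp (2 * θ) - 1) / 2 * ∑ i ∈ S, ∑ j ∈ T, P i j) := by
        simp only [hexp, sum_sum_ite_mem_mul]
    _ ≤ exp (p * #S * #T * ((exp (2 * θ) - 1) / 2)) := by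
      have : 1 ≤ exp (2 * θ) := one_le_exp (by positivity)
      rw [mul_comm (p * #S * #T)]
      gcongr

end HasIndependentEdges

end IndependentEdges

section LightPairs

theorem hasSum_half_pow_natAbs : HasSum (fun k : ℤ => (1 / 2 : ℝ) ^ k.natAbs) 3 := by
  have hgeom : HasSum (fun k : ℕ => (1 / 2 : ℝ) ^ k) 2 := hasSum_geometric_two
  have h := HasSum.of_nat_of_neg (f := fun k : ℤ => (1 / 2 : ℝ) ^ k.natAbs)
    (by simpa using hgeom) (by simpa using hgeom)
  norm_num at h
  simpa using h

/-- The integer vectors of squared Euclidean norm at most `R`. -/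
noncomputable def latticeBall (ι : Type*) [Fintype ι] [DecidableEq ι] (R : ℕ) : Finset (ι → ℤ) :=
  (Fintype.piFinset fun _ => Icc (-(R : ℤ)) R).filter fun z => ∑ i, z i ^ 2 ≤ R

variable {ι : Type*} [Fintype ι]

theorem mem_latticeBall [DecidableEq ι] {R : ℕ} {z : ι → ℤ} :
    z ∈ latticeBall ι R ↔ ∑ i, z i ^ 2 ≤ R := by
  simp only [latticeBall, mem_filter, Fintype.mem_piFinset, mem_Icc, and_iff_right_iff_imp]
  intro hz i
  rw [← abs_le, Int.abs_eq_natAbs]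
  exact ((Int.natAbs_le_self_sq _).trans
    (single_le_sum (f := fun i => z i ^ 2) (fun _ _ => sq_nonneg _) (mem_univ i))).trans hz

/-- Each point `z` of the ball has weight `∏ i, 2 ^ (-|z i|) ≥ 2 ^ (-R)`, and all integer vectors
together have weight `3 ^ card ι`. -/
theorem card_latticeBall_le [DecidableEq ι] (R : ℕ) :
    (#(latticeBall ι R) : ℝ) ≤ 2 ^ R * 3 ^ Fintype.card ι := by
  have hweight (z : ι → ℤ) (hz : z ∈ latticeBall ι R) :
      1 ≤ (2 : ℝ) ^ R * ∏ i, (1 / 2 : ℝ) ^ (z i).natAbs := by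
    have hle : ∑ i, (z i).natAbs ≤ R := by
      have hsq := (sum_le_sum fun i _ => Int.natAbs_le_self_sq (z i)).trans (mem_latticeBall.1 hz)
      exact_mod_cast hsq
    rw [prod_pow_eq_pow_sum]
    calc (1 : ℝ) = 2 ^ R * (1 / 2) ^ R := by rw [← mul_pow]; norm_num
      _ ≤ 2 ^ R * (1 / 2) ^ ∑ i, (z i).natAbs := by
        gcongr 2 ^ R * ?_
        exact pow_le_pow_of_le_one (by norm_num) (by norm_num) hle
  calc (#(latticeBall ι R) : ℝ) = ∑ _z ∈ latticeBall ι R, (1 : ℝ) := by simp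
    _ ≤ ∑ z ∈ latticeBall ι R, 2 ^ R * ∏ i, (1 / 2 : ℝ) ^ (z i).natAbs := sum_le_sum hweight
    _ ≤ ∑ z ∈ Fintype.piFinset fun _ : ι => Icc (-(R : ℤ)) R,
          2 ^ R * ∏ i, (1 / 2 : ℝ) ^ (z i).natAbs :=
      sum_le_sum_of_subset_of_nonneg (filter_subset _ _) fun _ _ _ => by positivity
    _ = 2 ^ R * (∑ k ∈ Icc (-(R : ℤ)) R, (1 / 2 : ℝ) ^ k.natAbs) ^ Fintype.card ι := by
      rw [← mul_sum, ← prod_univ_sum (fun _ : ι => Icc (-(R : ℤ)) R)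
        fun _ k => (1 / 2 : ℝ) ^ k.natAbs, prod_const, card_univ]
    _ ≤ 2 ^ R * 3 ^ Fintype.card ι := by
      gcongr
      exact sum_le_hasSum _ (fun _ _ => by positivity) hasSum_half_pow_natAbs

/-- The truncation of `x` to `0` outside of `[-θ, θ]`. -/
noncomputable def lightPart (θ x : ℝ) : ℝ := if |x| ≤ θ then x else 0

theorem abs_lightPart_le {θ : ℝ} (hθ : 0 ≤ θ) (x : ℝ) : |lightPart θ x| ≤ θ := by
  unfold lightPart
  split_ifs with h
  · exact h
  · simpa

theorem lightPart_sq_le (θ x : ℝ) : lightPart θ x ^ 2 ≤ x ^ 2 := by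
  unfold lightPart
  split_ifs
  · rfl
  · simpa using sq_nonneg x

/-- At the integer vectors of norm at most `4 √n`, the part of the quadratic form of `M` coming
from the light pairs, those with `|z i * z j| ≤ 2 √a`, is of order `n √a`. -/
def HasLightBound {n : ℕ} (M : Matrix (Fin n) (Fin n) ℝ) (a ρ : ℝ) : Prop :=
  ∀ z : Fin n → ℤ, ∑ i, z i ^ 2 ≤ 16 * n →
    |∑ i, ∑ j, lightPart (2 * √a) (z i * z j) * M i j| ≤ 4 * (60 + ρ) * n * √a

variable {Ω : Type*} [MeasurableSpace Ω] {μ : Measure Ω} [IsProbabilityMeasure μ] {n : ℕ}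
  {G : Ω → SimpleGraph (Fin n)} {a ρ : ℝ}

theorem HasIndependentEdges.measureReal_le_light_sum_le (hG : HasIndependentEdges μ G)
    (hP : ∀ i j, edgeProbability μ G i j ≤ a / n) (hn : 0 < n) (ha : 0 < a)
    (W : Fin n → Fin n → ℝ) (hW : ∀ i j, |W i j| ≤ 2 * √a)
    (hWsq : ∑ i, ∑ j, W i j ^ 2 ≤ (16 * n) ^ 2) (κ : ℝ) :
    μ.real {ω | 4 * κ * n * √a ≤
        ∑ i, ∑ j, W i j * (adjacency (G ω) - edgeProbability μ G) i j} ≤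
      exp ((32 - κ) * n) := by
  have : 0 < √a := sqrt_pos.2 ha
  have : (0 : ℝ) < n := by exact_mod_cast hn
  have hw (i j) : |2 * (W i j / (4 * √a))| ≤ 1 := by
    rw [abs_mul, abs_div, abs_two, abs_of_pos (by positivity : 0 < 4 * √a), ← mul_div_assoc,
      div_le_one (by positivity)]
    linarith [hW i j]
  have hwsq : ∑ i, ∑ j, (W i j / (4 * √a)) ^ 2 ≤ (16 * n) ^ 2 / (16 * a) := by
    simp only [div_pow, mul_pow _ (√a), sq_sqrt ha.le, ← sum_div]
    norm_num at hWsq ⊢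
    gcongr
  have hset : {ω | 4 * κ * n * √a ≤
        ∑ i, ∑ j, W i j * (adjacency (G ω) - edgeProbability μ G) i j} =
      {ω | κ * n ≤
        ∑ i, ∑ j, W i j / (4 * √a) * (adjacency (G ω) - edgeProbability μ G) i j} := by
    ext ω
    simp only [Set.mem_ofPred_eq, div_mul_eq_mul_div, ← sum_div]
    rw [le_div_iff₀ (by positivity)]
    ring_nf
  rw [hset]
  refine (hG.measureReal_le_sum_mul_sub_le hP _ hw _).trans (exp_le_exp.2 ?_)
  calc a / n * (2 * ∑ i, ∑ j, (W i j / (4 * √a)) ^ 2) - κ * n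
      ≤ a / n * (2 * ((16 * n) ^ 2 / (16 * a))) - κ * n := by gcongr
    _ = (32 - κ) * n := by field_simp; ring

theorem sum_sum_lightPart_sq_le (θ : ℝ) (x : ι → ℝ) :
    ∑ i, ∑ j, lightPart θ (x i * x j) ^ 2 ≤ (∑ i, x i ^ 2) ^ 2 := by
  rw [sq (∑ i, x i ^ 2), sum_mul_sum]
  exact sum_le_sum fun i _ => sum_le_sum fun j _ =>
    (lightPart_sq_le _ _).trans_eq (mul_pow _ _ _)

theorem card_latticeBall_mul_exp_le (hn : 0 < n) (hρ : 0 ≤ ρ) :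
    #(latticeBall (Fin n) (16 * n)) * (2 * exp ((32 - (60 + ρ)) * n)) ≤ exp (-ρ) := by
  have hn1 : (1 : ℝ) ≤ n := by exact_mod_cast hn
  have h2 : (2 : ℝ) ≤ exp 1 := by linarith [add_one_le_exp (1 : ℝ)]
  have h3 : (3 : ℝ) ≤ exp 2 := by linarith [add_one_le_exp (2 : ℝ)]
  calc #(latticeBall (Fin n) (16 * n)) * (2 * exp ((32 - (60 + ρ)) * n))
      ≤ (2 ^ (16 * n) * 3 ^ n) * (2 * exp ((32 - (60 + ρ)) * n)) := by
        gcongr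
        simpa using card_latticeBall_le (ι := Fin n) (16 * n)
    _ ≤ (exp 1 ^ (16 * n) * exp 2 ^ n) * (exp 1 * exp ((32 - (60 + ρ)) * n)) := by gcongr
    _ = exp (16 * n + 2 * n + (1 + (32 - (60 + ρ)) * n)) := by
        simp only [← exp_nat_mul, ← exp_add]
        push_cast
        ring_nf
    _ ≤ exp (-ρ) := exp_le_exp.2 (by nlinarith)

theorem HasIndependentEdges.measureReal_not_hasLightBound_le (hG : HasIndependentEdges μ G)
    (hP : ∀ i j, edgeProbability μ G i j ≤ a / n) (hn : 0 < n) (ha : 0 < a) (hρ : 0 ≤ ρ) :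
    μ.real {ω | ¬ HasLightBound (adjacency (G ω) - edgeProbability μ G) a ρ} ≤ exp (-ρ) := by
  set W : (Fin n → ℤ) → Fin n → Fin n → ℝ := fun z i j => lightPart (2 * √a) (z i * z j)
  let exceeds (w : Fin n → Fin n → ℝ) : Set Ω := {ω | 4 * (60 + ρ) * n * √a ≤
    ∑ i, ∑ j, w i j * (adjacency (G ω) - edgeProbability μ G) i j}
  have hsub : {ω | ¬ HasLightBound (adjacency (G ω) - edgeProbability μ G) a ρ} ⊆
      ⋃ z ∈ latticeBall (Fin n) (16 * n), exceeds (W z) ∪ exceeds (-W z) := by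
    intro ω hω
    simp only [HasLightBound, Set.mem_ofPred_eq, not_forall, not_le] at hω
    obtain ⟨z, hz, hlt⟩ := hω
    refine Set.mem_biUnion (mem_latticeBall.2 (by exact_mod_cast hz)) ?_
    refine (lt_abs.1 hlt).imp (fun h => h.le) fun h => ?_
    simp only [exceeds, W, Pi.neg_apply, neg_mul, sum_neg_distrib, Set.mem_ofPred_eq]
    exact h.le
  have hexceeds (z) (hz : z ∈ latticeBall (Fin n) (16 * n)) :
      μ.real (exceeds (W z) ∪ exceeds (-W z)) ≤ 2 * exp ((32 - (60 + ρ)) * n) := by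
    have habs (i j) : |W z i j| ≤ 2 * √a := abs_lightPart_le (by positivity) _
    have hsq : ∑ i, ∑ j, W z i j ^ 2 ≤ (16 * n) ^ 2 := by
      refine (sum_sum_lightPart_sq_le _ _).trans ?_
      gcongr
      exact_mod_cast mem_latticeBall.1 hz
    refine (measureReal_union_le _ _).trans ?_
    rw [two_mul]
    exact add_le_add (hG.measureReal_le_light_sum_le hP hn ha _ habs hsq _)
      (hG.measureReal_le_light_sum_le hP hn ha _ (by simpa using habs) (by simpa using hsq) _)
  calc μ.real {ω | ¬ HasLightBound (adjacency (G ω) - edgeProbability μ G) a ρ}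
      ≤ μ.real (⋃ z ∈ latticeBall (Fin n) (16 * n), exceeds (W z) ∪ exceeds (-W z)) :=
        measureReal_mono hsub (measure_ne_top _ _)
    _ ≤ ∑ z ∈ latticeBall (Fin n) (16 * n), μ.real (exceeds (W z) ∪ exceeds (-W z)) :=
        measureReal_biUnion_finset_le _ _
    _ ≤ ∑ _z ∈ latticeBall (Fin n) (16 * n), 2 * exp ((32 - (60 + ρ)) * n) := sum_le_sum hexceeds
    _ ≤ exp (-ρ) := by
        rw [sum_const, nsmul_eq_mul]
        exact card_latticeBall_mul_exp_le hn hρ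

end LightPairs

section Discrepancy

theorem sum_nonempty_exp_neg_card_mul_le {ι : Type*} [Fintype ι] {κ : ℝ} (hκ : 0 ≤ κ) (x : ℝ) :
    ∑ S : Finset ι with S.Nonempty, exp (-(#S * (κ + x))) ≤
      exp (-κ) * exp (Fintype.card ι * exp (-x)) := by
  calc ∑ S : Finset ι with S.Nonempty, exp (-(#S * (κ + x)))
      ≤ ∑ S : Finset ι with S.Nonempty, exp (-κ) * exp (-x) ^ #S := by
        refine sum_le_sum fun S hS => ?_
        have hcard : (1 : ℝ) ≤ #S := by exact_mod_cast (mem_filter.1 hS).2.card_pos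
        rw [← exp_nat_mul, ← exp_add, exp_le_exp]
        linarith [le_mul_of_one_le_left hκ hcard]
    _ ≤ ∑ S : Finset ι, exp (-κ) * exp (-x) ^ #S :=
        sum_le_sum_of_subset_of_nonneg (filter_subset _ _) fun _ _ _ => by positivity
    _ = exp (-κ) * (exp (-x) + 1) ^ Fintype.card ι := by
        rw [← mul_sum, ← Fintype.sum_pow_mul_eq_add_pow]
        simp only [one_pow, mul_one]
    _ ≤ exp (-κ) * exp (exp (-x)) ^ Fintype.card ι := by
        gcongr
        exact add_one_le_exp _
    _ = exp (-κ) * exp (Fintype.card ι * exp (-x)) := by rw [← exp_nat_mul]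

theorem exp_neg_one_le_half : exp (-1) ≤ 1 / 2 := by
  rw [exp_neg, one_div]
  gcongr
  linarith [add_one_le_exp (1 : ℝ)]

theorem exp_neg_natCast_mul_le (m s : ℕ) : exp (-(m * s)) ≤ ((1 / 2) ^ m) ^ s := by
  rw [← pow_mul, show -((m : ℝ) * s) = (m * s : ℕ) * (-1) by push_cast; ring, exp_nat_mul]
  gcongr
  exact exp_neg_one_le_half

theorem sum_exp_neg_add_natCast_le (κ : ℝ) (N : ℕ) :
    ∑ s ∈ range N, exp (-(κ + s)) ≤ 2 * exp (-κ) := by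
  calc ∑ s ∈ range N, exp (-(κ + s)) ≤ ∑ s ∈ range N, exp (-κ) * (1 / 2) ^ s := by
        refine sum_le_sum fun s _ => ?_
        rw [neg_add, exp_add]
        gcongr
        simpa using exp_neg_natCast_mul_le 1 s
    _ ≤ 2 * exp (-κ) := by
        rw [← mul_sum, mul_comm]
        gcongr
        exact sum_geometric_two_le _

/-- The price, in the exponent of the union bound, of a set of `k` vertices at the dyadic level
`s`. It exceeds the logarithm of the number of such sets, and grows with `s` so that the failure
probabilities of all levels are summable. -/
noncomputable def levelPenalty (ρ n k : ℝ) (s : ℕ) : ℝ := k * (ρ + 4 * s) + n * (1 / 8) ^ s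

theorem levelPenalty_nonneg {ρ n k : ℝ} (hρ : 0 ≤ ρ) (hn : 0 ≤ n) (hk : 0 ≤ k) (s : ℕ) :
    0 ≤ levelPenalty ρ n k s := by
  unfold levelPenalty
  positivity

theorem sum_exp_neg_levelPenalty_le {ι : Type*} [Fintype ι] {ρ : ℝ} (hρ : 0 ≤ ρ) (s : ℕ) :
    ∑ S : Finset ι with S.Nonempty, exp (-levelPenalty ρ (Fintype.card ι) #S s) ≤
      exp (-(ρ + s)) := by
  set n := Fintype.card ι
  have hsplit (S : Finset ι) : exp (-levelPenalty ρ n #S s) =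
      exp (-(#S * (ρ + s + 3 * s))) * exp (-(n * (1 / 8) ^ s)) := by
    rw [← exp_add, levelPenalty]
    ring_nf
  have hexp : exp (-(3 * s)) ≤ (1 / 8) ^ s := by
    refine (exp_neg_natCast_mul_le 3 s).trans_eq ?_
    norm_num
  calc ∑ S : Finset ι with S.Nonempty, exp (-levelPenalty ρ n #S s)
      ≤ exp (-(ρ + s)) * exp (n * exp (-(3 * s))) * exp (-(n * (1 / 8) ^ s)) := by
        simp only [hsplit, ← sum_mul]
        gcongr
        exact sum_nonempty_exp_neg_card_mul_le (by positivity) _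
    _ ≤ exp (-(ρ + s)) * exp (n * (1 / 8) ^ s) * exp (-(n * (1 / 8) ^ s)) := by gcongr
    _ = exp (-(ρ + s)) := by rw [mul_assoc, ← exp_add, add_neg_cancel, exp_zero, mul_one]

/-- The number of edges between a set `S` of vertices of level `s` and a set `T` of vertices of
level `t` is not much larger than its expectation. Only the pairs of levels with `L ≤ s + t`
occur in heavy pairs of coordinates, and a vector of norm at most `4 √n` with integer entries has
less than `n + 3` levels. -/
def HasDiscrepancy {n : ℕ} (A : Matrix (Fin n) (Fin n) ℝ) (a ρ : ℝ) (L : ℕ) : Prop :=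
  ∀ s < n + 3, ∀ t < n + 3, L ≤ s + t → ∀ S T : Finset (Fin n),
    ((s + t - L : ℕ) + 1) * (log 2 / 2) * ∑ i ∈ S, ∑ j ∈ T, A i j ≤
      a / n * #S * #T * 2 ^ (s + t - L) + (levelPenalty ρ n #S s + levelPenalty ρ n #T t)

theorem exists_nonempty_of_not_hasDiscrepancy {n : ℕ} {A : Matrix (Fin n) (Fin n) ℝ} {a ρ : ℝ}
    {L : ℕ} (ha : 0 ≤ a) (hρ : 0 ≤ ρ) (hA : ¬ HasDiscrepancy A a ρ L) :
    ∃ s < n + 3, ∃ t < n + 3, ∃ S : Finset (Fin n), S.Nonempty ∧ ∃ T : Finset (Fin n),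
      T.Nonempty ∧
      a / n * #S * #T * 2 ^ (s + t - L) + (levelPenalty ρ n #S s + levelPenalty ρ n #T t) ≤
        ((s + t - L : ℕ) + 1) * (log 2 / 2) * ∑ i ∈ S, ∑ j ∈ T, A i j := by
  simp only [HasDiscrepancy, not_forall, not_le] at hA
  obtain ⟨s, hs, t, ht, -, S, T, hlt⟩ := hA
  have hpenalty (U : Finset (Fin n)) (u : ℕ) : 0 ≤ levelPenalty ρ n #U u :=
    levelPenalty_nonneg hρ n.cast_nonneg (#U).cast_nonneg u
  have hsum : ∑ i ∈ S, ∑ j ∈ T, A i j ≠ 0 := by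
    intro h
    rw [h, mul_zero] at hlt
    exact hlt.not_ge (add_nonneg (by positivity) (add_nonneg (hpenalty S s) (hpenalty T t)))
  exact ⟨s, hs, t, ht, S, nonempty_of_sum_ne_zero hsum, T,
    nonempty_of_sum_ne_zero (sum_comm.symm.trans_ne hsum), hlt.le⟩

variable {Ω : Type*} [MeasurableSpace Ω] {μ : Measure Ω} [IsProbabilityMeasure μ] {n : ℕ}
  {G : Ω → SimpleGraph (Fin n)} {a ρ : ℝ}

/-- Chernoff's bound at the parameter `θ = (k + 1) * log 2 / 2`, for which
`exp (2 * θ) = 2 ^ (k + 1)`. -/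
theorem HasIndependentEdges.measureReal_edgeCount_ge_le (hG : HasIndependentEdges μ G) {p : ℝ}
    (hp : ∀ i j, edgeProbability μ G i j ≤ p) (hp0 : 0 ≤ p) (S T : Finset (Fin n)) (k : ℕ)
    (x : ℝ) :
    μ.real {ω | p * #S * #T * 2 ^ k + x ≤
      (k + 1) * (log 2 / 2) * ∑ i ∈ S, ∑ j ∈ T, adjacency (G ω) i j} ≤ exp (-x) := by
  have : 0 < log 2 := log_pos one_lt_two
  set θ := ((k : ℝ) + 1) * (log 2 / 2)
  have hθ : 0 < θ := by positivity
  have hexp : exp (2 * θ) = 2 ^ (k + 1) := by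
    rw [show 2 * θ = ((k + 1 : ℕ) : ℝ) * log 2 by simp only [θ]; push_cast; ring, exp_nat_mul,
      exp_log two_pos]
  have hset : {ω | p * #S * #T * 2 ^ k + x ≤ θ * ∑ i ∈ S, ∑ j ∈ T, adjacency (G ω) i j} =
      {ω | (p * #S * #T * 2 ^ k + x) / θ ≤ ∑ i ∈ S, ∑ j ∈ T, adjacency (G ω) i j} := by
    simp only [div_le_iff₀' hθ]
  rw [hset]
  refine (measure_ge_le_exp_mul_mgf _ hθ.le (hG.integrable_exp_mul_sum_adjacency θ S T)).trans ?_
  refine (mul_le_mul_of_nonneg_left (hG.mgf_sum_adjacency_le hp hθ.le S T) (exp_pos _).le).trans ?_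
  rw [neg_mul, mul_div_cancel₀ _ hθ.ne', ← exp_add, exp_le_exp, hexp, pow_succ]
  have : 0 ≤ p * #S * #T := by positivity
  linarith

theorem HasIndependentEdges.measureReal_not_hasDiscrepancy_le (hG : HasIndependentEdges μ G)
    (hP : ∀ i j, edgeProbability μ G i j ≤ a / n) (ha : 0 ≤ a) (hρ : 0 ≤ ρ) (L : ℕ) :
    μ.real {ω | ¬ HasDiscrepancy (adjacency (G ω)) a ρ L} ≤ 4 * exp (-ρ) := by
  let 𝒮 : Finset (Finset (Fin n)) := univ.filter Finset.Nonempty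
  let x : ℕ → Finset (Fin n) → ℝ := fun s S => levelPenalty ρ n #S s
  let dense : (ℕ × ℕ) × Finset (Fin n) × Finset (Fin n) → Set Ω := fun ((s, t), S, T) =>
    {ω | a / n * #S * #T * 2 ^ (s + t - L) + (x s S + x t T) ≤
      ((s + t - L : ℕ) + 1) * (log 2 / 2) * ∑ i ∈ S, ∑ j ∈ T, adjacency (G ω) i j}
  let I := (range (n + 3) ×ˢ range (n + 3)) ×ˢ 𝒮 ×ˢ 𝒮
  have hcover : {ω | ¬ HasDiscrepancy (adjacency (G ω)) a ρ L} ⊆ ⋃ e ∈ I, dense e := by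
    intro ω hω
    obtain ⟨s, hs, t, ht, S, hS, T, hT, hle⟩ := exists_nonempty_of_not_hasDiscrepancy ha hρ hω
    simp only [Set.mem_iUnion]
    exact ⟨((s, t), S, T), by simp [I, 𝒮, hs, ht, hS, hT], hle⟩
  have hlevel : ∑ s ∈ range (n + 3), ∑ S ∈ 𝒮, exp (-x s S) ≤ 2 * exp (-ρ) := by
    refine (sum_le_sum fun s _ => ?_).trans (sum_exp_neg_add_natCast_le ρ (n + 3))
    simpa [x, 𝒮] using sum_exp_neg_levelPenalty_le (ι := Fin n) hρ s
  calc μ.real {ω | ¬ HasDiscrepancy (adjacency (G ω)) a ρ L}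
      ≤ ∑ e ∈ I, μ.real (dense e) :=
        (measureReal_mono hcover (measure_ne_top _ _)).trans (measureReal_biUnion_finset_le _ _)
    _ ≤ ∑ e ∈ I, exp (-x e.1.1 e.2.1) * exp (-x e.1.2 e.2.2) := by
        refine sum_le_sum fun e _ => ?_
        rw [← exp_add, ← neg_add]
        exact hG.measureReal_edgeCount_ge_le hP (by positivity) _ _ _ _
    _ = (∑ s ∈ range (n + 3), ∑ S ∈ 𝒮, exp (-x s S)) *
          ∑ t ∈ range (n + 3), ∑ T ∈ 𝒮, exp (-x t T) := by
        simp only [I, sum_product, sum_mul_sum]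
    _ ≤ (2 * exp (-ρ)) * (2 * exp (-ρ)) := by gcongr
    _ ≤ 4 * exp (-ρ) := by
        have : exp (-ρ) ≤ 1 := exp_le_one_iff.2 (neg_nonpos.2 hρ)
        linarith [mul_le_of_le_one_left (exp_pos (-ρ)).le this]

end Discrepancy

section DegreeTail

/-- Few vertices of the weighted graph have a degree much larger than `a`. The offset is a bound
for the logarithm of the expectation of `exp (weightedDegree A i / 2)`. -/
def HasDegreeTail {n : ℕ} (A : Matrix (Fin n) (Fin n) ℝ) (a ρ : ℝ) : Prop :=
  ∑ i, exp (weightedDegree A i / 2 - 9 / 10 * a) ≤ n * exp ρ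

variable {Ω : Type*} [MeasurableSpace Ω] {μ : Measure Ω} [IsProbabilityMeasure μ] {n : ℕ}
  {G : Ω → SimpleGraph (Fin n)} {a : ℝ}

namespace HasIndependentEdges

variable (hG : HasIndependentEdges μ G)
include hG

theorem integrable_exp_weightedDegree_adjacency (i : Fin n) :
    Integrable (fun ω => exp (weightedDegree (adjacency (G ω)) i / 2 - 9 / 10 * a)) μ := by
  have h := hG.integrable_exp_mul_sum_adjacency (1 / 2) {i} univ
  simpa [sub_eq_add_neg, exp_add, weightedDegree, div_eq_inv_mul] using h.mul_const _

theorem integral_exp_weightedDegree_adjacency_le (hP : ∀ i j, edgeProbability μ G i j ≤ a / n)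
    (ha : 0 ≤ a) (i : Fin n) :
    ∫ ω, exp (weightedDegree (adjacency (G ω)) i / 2 - 9 / 10 * a) ∂μ ≤ 1 := by
  have hn : (n : ℝ) ≠ 0 := Nat.cast_ne_zero.2 i.pos.ne'
  have hmgf := hG.mgf_sum_adjacency_le hP (θ := 1 / 2) (by positivity) {i} univ
  calc ∫ ω, exp (weightedDegree (adjacency (G ω)) i / 2 - 9 / 10 * a) ∂μ
      = mgf (fun ω => ∑ k ∈ {i}, ∑ j, adjacency (G ω) k j) μ (1 / 2) * exp (-(9 / 10 * a)) := by
        simp only [mgf, sum_singleton, sub_eq_add_neg, exp_add, integral_mul_const]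
        congr! 4
        exact div_eq_inv_mul _ _ |>.trans (by rw [weightedDegree, one_div])
    _ ≤ exp (a * ((exp 1 - 1) / 2)) * exp (-(9 / 10 * a)) := by
        gcongr
        refine hmgf.trans_eq ?_
        simp [hn]
    _ ≤ 1 := by
        rw [← exp_add, exp_le_one_iff]
        have hexp : (exp 1 - 1) / 2 ≤ 9 / 10 := by linarith [exp_one_lt_d9]
        linarith [mul_le_mul_of_nonneg_left hexp ha]

theorem measureReal_not_hasDegreeTail_le (hP : ∀ i j, edgeProbability μ G i j ≤ a / n)
    (ha : 0 ≤ a) (hn : 0 < n) (ρ : ℝ) :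
    μ.real {ω | ¬ HasDegreeTail (adjacency (G ω)) a ρ} ≤ exp (-ρ) := by
  let F : Ω → ℝ := fun ω => ∑ i, exp (weightedDegree (adjacency (G ω)) i / 2 - 9 / 10 * a)
  have hint (i) := hG.integrable_exp_weightedDegree_adjacency (a := a) i
  have hmean : ∫ ω, F ω ∂μ ≤ n := by
    rw [integral_finsetSum _ fun i _ => hint i]
    simpa using sum_le_sum fun i (_ : i ∈ univ) =>
      hG.integral_exp_weightedDegree_adjacency_le hP ha i
  have hmarkov : n * exp ρ * μ.real {ω | n * exp ρ ≤ F ω} ≤ n :=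
    (mul_meas_ge_le_integral_of_nonneg (ae_of_all _ fun ω => by positivity)
      (integrable_finsetSum _ fun i _ => hint i) _).trans hmean
  have hmono : {ω | ¬ HasDegreeTail (adjacency (G ω)) a ρ} ⊆ {ω | n * exp ρ ≤ F ω} :=
    fun ω hω => (not_le.1 hω).le
  refine (measureReal_mono hmono).trans ?_
  rw [exp_neg, ← one_div, le_div_iff₀' (exp_pos ρ)]
  have : (0 : ℝ) < n := by exact_mod_cast hn
  rwa [mul_assoc, mul_le_iff_le_one_right this] at hmarkov

end HasIndependentEdges

end DegreeTail

section DyadicSums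

theorem sum_add_one_div_two_pow_le (m : ℕ) : ∑ i ∈ range m, ((i : ℝ) + 1) / 2 ^ i ≤ 4 := by
  have h : ∑ i ∈ range m, ((i : ℝ) + 1) / 2 ^ i = 4 - (2 * m + 4) / 2 ^ m := by
    induction m with
    | zero => norm_num
    | succ m ih =>
      rw [sum_range_succ, ih, pow_succ]
      push_cast
      field_simp
      ring
  rw [h]
  exact sub_le_self _ (by positivity)

theorem sum_ite_le_sub_add_one_div_two_pow_le (N m : ℕ) :
    ∑ s ∈ range N, (if s ≤ m then ((m - s : ℕ) + 1 : ℝ) / 2 ^ (m - s) else 0) ≤ 4 := by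
  calc ∑ s ∈ range N, (if s ≤ m then ((m - s : ℕ) + 1 : ℝ) / 2 ^ (m - s) else 0)
      ≤ ∑ s ∈ range (m + 1), ((m - s : ℕ) + 1 : ℝ) / 2 ^ (m - s) := by
        rw [← sum_filter]
        refine sum_le_sum_of_subset_of_nonneg ?_ fun _ _ _ => by positivity
        intro s
        simp only [mem_filter, mem_range]
        omega
    _ = ∑ s ∈ range (m + 1), ((s : ℝ) + 1) / 2 ^ s := by
        rw [← sum_range_reflect (fun s : ℕ => ((s : ℝ) + 1) / 2 ^ s)]
        simp
    _ ≤ 4 := sum_add_one_div_two_pow_le _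

theorem sum_ite_add_lt_two_pow_le (N L s : ℕ) :
    ∑ t ∈ range N, (if t + L < s then (2 : ℝ) ^ t else 0) ≤ 2 ^ s / 2 ^ L := by
  calc ∑ t ∈ range N, (if t + L < s then (2 : ℝ) ^ t else 0) ≤ ∑ t ∈ range (s - L), 2 ^ t := by
        rw [← sum_filter]
        refine sum_le_sum_of_subset_of_nonneg ?_ fun _ _ _ => by positivity
        intro t
        simp only [mem_filter, mem_range]
        omega
    _ ≤ 2 ^ s / 2 ^ L := by
        rw [geom_sum_eq (by norm_num)]
        rcases le_total L s with h | h
        · rw [pow_sub₀ _ (by norm_num) h, ← div_eq_mul_inv]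
          norm_num
        · rw [Nat.sub_eq_zero_of_le h, pow_zero, sub_self, zero_div]
          positivity

/-- The mass of a dyadic level with `k` vertices: a bound for
`4 ^ s * levelPenalty ρ n k s / (2 * s + 1)` that is summable over the levels. -/
noncomputable def levelMass (ρ n k : ℝ) (s : ℕ) : ℝ := k * 4 ^ s * (ρ + 2) + n * (1 / 2) ^ s

/-- The bound for `2 ^ (s + t)` times the number of edges between the levels `s` and `t` that comes
from the degrees, used if `s` is much larger than `t`. -/
noncomputable def degreeTerm (a : ℝ) (L : ℕ) (k : ℕ → ℝ) (s t : ℕ) : ℝ :=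
  2 * a * (k s * 2 ^ s) * if t + L < s then 2 ^ t else 0

/-- The contribution of the expected number of edges to the discrepancy bound for `2 ^ (s + t)`
times the number of edges between the levels `s` and `t`. -/
noncomputable def productTerm (a n : ℝ) (L : ℕ) (k : ℕ → ℝ) (s t : ℕ) : ℝ :=
  3 * (a / n) / 2 ^ L * (k s * 4 ^ s * (k t * 4 ^ t))

/-- The contribution of `levelPenalty ρ n (k t) t` to the discrepancy bound for `2 ^ (s + t)` times
the number of edges between the levels `s` and `t`. -/
noncomputable def penaltyTerm (ρ n : ℝ) (L : ℕ) (k : ℕ → ℝ) (s t : ℕ) : ℝ :=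
  3 * 2 ^ L * (if s ≤ t + L then ((t + L - s : ℕ) + 1 : ℝ) / 2 ^ (t + L - s) else 0) *
    levelMass ρ n (k t) t

variable {n a ρ : ℝ} {L N s t : ℕ}

theorem levelMass_nonneg {k : ℝ} (hρ : 0 ≤ ρ) (hn : 0 ≤ n) (hk : 0 ≤ k) (s : ℕ) :
    0 ≤ levelMass ρ n k s := by
  unfold levelMass
  positivity

theorem two_pow_div_mul_levelPenalty_le {k : ℝ} (hρ : 0 ≤ ρ) (hn : 0 ≤ n) (hk : 0 ≤ k)
    (hs : s ≤ t + L) (hL : L ≤ s + t) :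
    2 ^ (s + t) / ((s + t - L : ℕ) + 1) * levelPenalty ρ n k t ≤
      2 ^ L * (((t + L - s : ℕ) + 1) / 2 ^ (t + L - s)) * levelMass ρ n k t := by
  set i := t + L - s
  set j := s + t - L
  have hpow : (2 : ℝ) ^ (s + t) = 2 ^ L * 4 ^ t / 2 ^ i := by
    rw [eq_div_iff (by positivity), show (4 : ℝ) = 2 ^ 2 by norm_num, ← pow_mul, ← pow_add,
      ← pow_add]
    congr 1
    omega
  have hinv : (1 : ℝ) / (j + 1) ≤ (i + 1) / (2 * t + 1) := by
    rw [div_le_div_iff₀ (by positivity) (by positivity)]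
    have hij : (i : ℝ) + j = 2 * t := by exact_mod_cast (by omega : i + j = 2 * t)
    have : (0 : ℝ) ≤ i * j := by positivity
    linarith
  have hpenalty : 1 / (2 * t + 1) * levelPenalty ρ n k t ≤ k * (ρ + 2) + n * (1 / 8) ^ t := by
    rw [one_div, inv_mul_le_iff₀ (by positivity), levelPenalty]
    have : 0 ≤ 2 * t * (n * (1 / 8) ^ t) + k * (2 * t * ρ) + 2 * k := by positivity
    linarith
  calc 2 ^ (s + t) / ((j : ℝ) + 1) * levelPenalty ρ n k t
      = 2 ^ L * 4 ^ t / 2 ^ i * (1 / ((j : ℝ) + 1)) * levelPenalty ρ n k t := by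
        rw [hpow]
        ring
    _ ≤ 2 ^ L * 4 ^ t / 2 ^ i * ((i + 1) / (2 * t + 1)) * levelPenalty ρ n k t := by
        have := levelPenalty_nonneg hρ hn hk t
        gcongr
    _ = 2 ^ L * 4 ^ t / 2 ^ i * (i + 1) * (1 / (2 * t + 1) * levelPenalty ρ n k t) := by ring
    _ ≤ 2 ^ L * 4 ^ t / 2 ^ i * (i + 1) * (k * (ρ + 2) + n * (1 / 8) ^ t) := by gcongr
    _ = 2 ^ L * ((i + 1) / 2 ^ i) * (k * 4 ^ t * (ρ + 2) + n * (4 * (1 / 8)) ^ t) := by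
        rw [mul_pow]
        ring
    _ = 2 ^ L * ((i + 1) / 2 ^ i) * levelMass ρ n k t := by
        rw [levelMass]
        norm_num

variable {k : ℕ → ℝ}

theorem two_pow_mul_le_of_discrepancy {e : ℝ} (hρ : 0 ≤ ρ) (hn : 0 ≤ n) (ha : 0 ≤ a)
    (hk : ∀ s, 0 ≤ k s) (hst : s ≤ t + L) (hts : t ≤ s + L) (hL : L ≤ s + t) (he : 0 ≤ e)
    (hdisc : ((s + t - L : ℕ) + 1) * (log 2 / 2) * e ≤
      a / n * k s * k t * 2 ^ (s + t - L) +
        (levelPenalty ρ n (k s) s + levelPenalty ρ n (k t) t)) :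
    2 ^ (s + t) * e ≤
      productTerm a n L k s t + (penaltyTerm ρ n L k s t + penaltyTerm ρ n L k t s) := by
  have hpenalty_t := two_pow_div_mul_levelPenalty_le hρ hn (hk t) hst hL
  have hpenalty_s := two_pow_div_mul_levelPenalty_le hρ hn (hk s) hts (hL.trans_eq (add_comm _ _))
  rw [add_comm t s] at hpenalty_s
  simp only [penaltyTerm, productTerm, hst, hts, if_true]
  have hks := hk s
  have hkt := hk t
  set j := s + t - L
  have he' : e ≤ 3 / ((j : ℝ) + 1) * (a / n * k s * k t * 2 ^ j +
      (levelPenalty ρ n (k s) s + levelPenalty ρ n (k t) t)) := by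
    have hlog : 1 / 3 ≤ log 2 / 2 := by linarith [log_two_gt_d9]
    rw [div_mul_eq_mul_div, le_div_iff₀ (by positivity)]
    linarith [mul_le_mul_of_nonneg_right hlog (by positivity : 0 ≤ ((j : ℝ) + 1) * e)]
  have hpow : (2 : ℝ) ^ (s + t) * 2 ^ j = 4 ^ s * 4 ^ t / 2 ^ L := by
    rw [eq_div_iff (by positivity), show (4 : ℝ) = 2 ^ 2 by norm_num, ← pow_mul, ← pow_mul,
      ← pow_add, ← pow_add, ← pow_add]
    congr 1
    omega
  have hj1 : (1 : ℝ) / (j + 1) ≤ 1 := (div_le_one (by positivity)).2 (by simp)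
  have hproduct : 1 / ((j : ℝ) + 1) * (a / n * k s * k t * (4 ^ s * 4 ^ t / 2 ^ L)) ≤
      a / n * k s * k t * (4 ^ s * 4 ^ t / 2 ^ L) :=
    mul_le_of_le_one_left (by positivity) hj1
  calc 2 ^ (s + t) * e
      ≤ 2 ^ (s + t) * (3 / ((j : ℝ) + 1) * (a / n * k s * k t * 2 ^ j +
          (levelPenalty ρ n (k s) s + levelPenalty ρ n (k t) t))) := by gcongr
    _ = 3 * (1 / ((j : ℝ) + 1) * (a / n * k s * k t * (2 ^ (s + t) * 2 ^ j))) +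
          (3 * (2 ^ (s + t) / ((j : ℝ) + 1) * levelPenalty ρ n (k t) t) +
            3 * (2 ^ (s + t) / ((j : ℝ) + 1) * levelPenalty ρ n (k s) s)) := by ring
    _ ≤ _ := by
        rw [hpow]
        refine add_le_add ?_ (add_le_add ?_ ?_)
        · exact (mul_le_mul_of_nonneg_left hproduct zero_le_three).trans_eq (by ring)
        · exact (mul_le_mul_of_nonneg_left hpenalty_t zero_le_three).trans_eq (by ring)
        · exact (mul_le_mul_of_nonneg_left hpenalty_s zero_le_three).trans_eq (by ring)

theorem two_pow_mul_le_degreeTerm {e : ℝ} (h : t + L < s) (he : e ≤ 2 * a * k s) :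
    2 ^ (s + t) * e ≤ degreeTerm a L k s t := by
  calc 2 ^ (s + t) * e ≤ 2 ^ (s + t) * (2 * a * k s) := by gcongr
    _ = degreeTerm a L k s t := by
        rw [degreeTerm, if_pos h, pow_add]
        ring

theorem degreeTerm_nonneg (ha : 0 ≤ a) (hk : ∀ s, 0 ≤ k s) (s t : ℕ) :
    0 ≤ degreeTerm a L k s t := by
  have := hk s
  unfold degreeTerm
  split_ifs <;> positivity

theorem productTerm_nonneg (ha : 0 ≤ a) (hn : 0 ≤ n) (hk : ∀ s, 0 ≤ k s) (s t : ℕ) :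
    0 ≤ productTerm a n L k s t := by
  have hs := hk s
  have ht := hk t
  unfold productTerm
  positivity

theorem penaltyTerm_nonneg (hρ : 0 ≤ ρ) (hn : 0 ≤ n) (hk : ∀ s, 0 ≤ k s) (s t : ℕ) :
    0 ≤ penaltyTerm ρ n L k s t := by
  have := levelMass_nonneg hρ hn (hk t) t
  unfold penaltyTerm
  split_ifs <;> positivity

theorem two_pow_mul_le_terms {e : ℝ} (hρ : 0 ≤ ρ) (hn : 0 ≤ n) (ha : 0 ≤ a) (hk : ∀ s, 0 ≤ k s)
    (he : 0 ≤ e) (hes : e ≤ 2 * a * k s) (het : e ≤ 2 * a * k t)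
    (hdisc : L ≤ s + t → ((s + t - L : ℕ) + 1) * (log 2 / 2) * e ≤
      a / n * k s * k t * 2 ^ (s + t - L) +
        (levelPenalty ρ n (k s) s + levelPenalty ρ n (k t) t)) :
    (if L ≤ s + t then 2 ^ (s + t) * e else 0) ≤
      (degreeTerm a L k s t + degreeTerm a L k t s) +
        (productTerm a n L k s t + (penaltyTerm ρ n L k s t + penaltyTerm ρ n L k t s)) := by
  have hdegree_st := degreeTerm_nonneg (L := L) ha hk s t
  have hdegree_ts := degreeTerm_nonneg (L := L) ha hk t s
  have hproduct := productTerm_nonneg (L := L) ha hn hk s t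
  have hpenalty_st := penaltyTerm_nonneg (L := L) hρ hn hk s t
  have hpenalty_ts := penaltyTerm_nonneg (L := L) hρ hn hk t s
  split_ifs with hL
  · rcases lt_or_ge (t + L) s with hst | hst
    · linarith [two_pow_mul_le_degreeTerm hst hes]
    rcases lt_or_ge (s + L) t with hts | hts
    · have := two_pow_mul_le_degreeTerm hts het
      rw [add_comm t s] at this
      linarith
    · linarith [two_pow_mul_le_of_discrepancy hρ hn ha hk hst hts hL he (hdisc hL)]
  · positivity

theorem sum_degreeTerm_le (ha : 0 ≤ a) (hL : a / 2 ^ L ≤ 2 * √a)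
    (hk : ∀ s, 0 ≤ k s) (hsum : ∑ s ∈ range N, k s * 4 ^ s ≤ 16 * n) :
    ∑ s ∈ range N, ∑ t ∈ range N, degreeTerm a L k s t ≤ 64 * n * √a := by
  have hrow (s : ℕ) :
      ∑ t ∈ range N, degreeTerm a L k s t ≤ 2 * (a / 2 ^ L) * (k s * 4 ^ s) := by
    have := hk s
    calc ∑ t ∈ range N, degreeTerm a L k s t ≤ 2 * a * (k s * 2 ^ s) * (2 ^ s / 2 ^ L) := by
          simp only [degreeTerm, ← mul_sum]
          gcongr
          exact sum_ite_add_lt_two_pow_le N L s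
      _ = 2 * (a / 2 ^ L) * (k s * 4 ^ s) := by
          rw [show (4 : ℝ) = 2 * 2 by norm_num, mul_pow]
          ring
  calc ∑ s ∈ range N, ∑ t ∈ range N, degreeTerm a L k s t
      ≤ 2 * (a / 2 ^ L) * ∑ s ∈ range N, k s * 4 ^ s := by
        rw [mul_sum]
        exact sum_le_sum fun s _ => hrow s
    _ ≤ 2 * (2 * √a) * (16 * n) := by
        have : 0 ≤ ∑ s ∈ range N, k s * 4 ^ s :=
          sum_nonneg fun s _ => mul_nonneg (hk s) (by positivity)
        gcongr
    _ = 64 * n * √a := by ring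

theorem sum_productTerm_le (hL : a / 2 ^ L ≤ 2 * √a) (hn : 0 < n)
    (hk : ∀ s, 0 ≤ k s) (hsum : ∑ s ∈ range N, k s * 4 ^ s ≤ 16 * n) :
    ∑ s ∈ range N, ∑ t ∈ range N, productTerm a n L k s t ≤ 1536 * n * √a := by
  have hsum0 : 0 ≤ ∑ s ∈ range N, k s * 4 ^ s :=
    sum_nonneg fun s _ => mul_nonneg (hk s) (by positivity)
  calc ∑ s ∈ range N, ∑ t ∈ range N, productTerm a n L k s t
      = 3 * (a / 2 ^ L) / n * ((∑ s ∈ range N, k s * 4 ^ s) * ∑ s ∈ range N, k s * 4 ^ s) := by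
        simp only [productTerm, ← mul_sum, sum_mul_sum]
        ring
    _ ≤ 3 * (2 * √a) / n * ((16 * n) * (16 * n)) := by gcongr
    _ = 1536 * n * √a := by
        field_simp
        ring

theorem sum_penaltyTerm_le (hL : 2 ^ L ≤ √a) (hρ : 0 ≤ ρ) (hn : 0 ≤ n) (hk : ∀ s, 0 ≤ k s)
    (hsum : ∑ s ∈ range N, k s * 4 ^ s ≤ 16 * n) :
    ∑ s ∈ range N, ∑ t ∈ range N, penaltyTerm ρ n L k s t ≤ 12 * (16 * ρ + 34) * n * √a := by
  have hmass (t : ℕ) := levelMass_nonneg hρ hn (hk t) t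
  have hcol (t : ℕ) :
      ∑ s ∈ range N, penaltyTerm ρ n L k s t ≤ 3 * 2 ^ L * 4 * levelMass ρ n (k t) t := by
    simp only [penaltyTerm, ← sum_mul, ← mul_sum]
    have := hmass t
    gcongr
    exact sum_ite_le_sub_add_one_div_two_pow_le N (t + L)
  have hmass_sum : ∑ t ∈ range N, levelMass ρ n (k t) t ≤ 16 * n * (ρ + 2) + n * 2 := by
    simp only [levelMass, sum_add_distrib, ← sum_mul, ← mul_sum]
    gcongr
    exact sum_geometric_two_le _
  calc ∑ s ∈ range N, ∑ t ∈ range N, penaltyTerm ρ n L k s t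
      ≤ 3 * 2 ^ L * 4 * ∑ t ∈ range N, levelMass ρ n (k t) t := by
        rw [sum_comm, mul_sum]
        exact sum_le_sum fun t _ => hcol t
    _ ≤ 3 * √a * 4 * (16 * n * (ρ + 2) + n * 2) := by
        have := sum_nonneg fun t (_ : t ∈ range N) => hmass t
        gcongr
    _ = 12 * (16 * ρ + 34) * n * √a := by ring

theorem sum_levels_two_pow_mul_le {e : ℕ → ℕ → ℝ} (hρ : 0 ≤ ρ) (hn : 0 < n) (ha : 0 ≤ a)
    (hL : 2 ^ L ≤ √a) (hL' : √a ≤ 2 ^ (L + 1)) (hk : ∀ s, 0 ≤ k s)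
    (hsum : ∑ s ∈ range N, k s * 4 ^ s ≤ 16 * n) (he : ∀ s t, 0 ≤ e s t)
    (hes : ∀ s t, e s t ≤ 2 * a * k s) (het : ∀ s t, e s t ≤ 2 * a * k t)
    (hdisc : ∀ s < N, ∀ t < N, L ≤ s + t → ((s + t - L : ℕ) + 1) * (log 2 / 2) * e s t ≤
      a / n * k s * k t * 2 ^ (s + t - L) +
        (levelPenalty ρ n (k s) s + levelPenalty ρ n (k t) t)) :
    ∑ s ∈ range N, ∑ t ∈ range N, (if L ≤ s + t then 2 ^ (s + t) * e s t else 0) ≤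
      (2500 + 400 * ρ) * n * √a := by
  have haL : a / 2 ^ L ≤ 2 * √a := by
    rw [div_le_iff₀ (by positivity)]
    calc a = √a * √a := (mul_self_sqrt ha).symm
      _ ≤ √a * 2 ^ (L + 1) := by gcongr
      _ = 2 * √a * 2 ^ L := by ring
  have hdegree := sum_degreeTerm_le ha haL hk hsum
  have hproduct := sum_productTerm_le haL hn hk hsum
  have hpenalty := sum_penaltyTerm_le hL hρ hn.le hk hsum
  refine (sum_le_sum fun s hs => sum_le_sum fun t ht => two_pow_mul_le_terms hρ hn.le ha hk
    (he s t) (hes s t) (het s t) (hdisc s (mem_range.1 hs) t (mem_range.1 ht))).trans ?_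
  simp only [sum_add_distrib]
  rw [sum_comm (f := fun s t => degreeTerm a L k t s),
    sum_comm (f := fun s t => penaltyTerm ρ n L k t s)]
  have hrho : 0 ≤ ρ * n * √a := by positivity
  have hone : 0 ≤ n * √a := by positivity
  linarith

end DyadicSums

section DyadicLevels

/-- The dyadic level set of the integer vector `z` where `2 ^ s ≤ |z i| < 2 ^ (s + 1)`. -/
def dyadicLevel {ι : Type*} [Fintype ι] (z : ι → ℤ) (s : ℕ) : Finset ι :=
  {i | z i ≠ 0 ∧ Nat.log 2 (z i).natAbs = s}

variable {ι : Type*} [Fintype ι] {z : ι → ℤ} {s t N : ℕ} {i j : ι}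

theorem two_pow_le_abs_of_mem_dyadicLevel (hi : i ∈ dyadicLevel z s) :
    (2 : ℝ) ^ s ≤ |(z i : ℝ)| := by
  obtain ⟨h0, rfl⟩ := (mem_filter.1 hi).2
  rw [← Int.cast_abs, ← Nat.cast_natAbs]
  exact_mod_cast Nat.pow_log_le_self 2 (Int.natAbs_ne_zero.2 h0)

theorem abs_lt_two_pow_of_mem_dyadicLevel (hi : i ∈ dyadicLevel z s) :
    |(z i : ℝ)| < 2 ^ (s + 1) := by
  obtain ⟨-, rfl⟩ := (mem_filter.1 hi).2
  rw [← Int.cast_abs, ← Nat.cast_natAbs]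
  exact_mod_cast Nat.lt_pow_succ_log_self one_lt_two _

theorem sum_eq_sum_dyadicLevel {M : Type*} [AddCommMonoid M] (hN : ∀ i, (z i).natAbs < 2 ^ N)
    (f : ι → M) (hf : ∀ i, z i = 0 → f i = 0) :
    ∑ i, f i = ∑ s ∈ range N, ∑ i ∈ dyadicLevel z s, f i := by
  have hlevel (i : ι) (hi : i ∈ univ.filter fun i => z i ≠ 0) :
      Nat.log 2 (z i).natAbs ∈ range N :=
    mem_range.2 (Nat.log_lt_of_lt_pow (Int.natAbs_ne_zero.2 (mem_filter.1 hi).2) (hN i))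
  calc ∑ i, f i = ∑ i with z i ≠ 0, f i :=
        (sum_filter_of_ne (p := fun i => z i ≠ 0) fun i _ => mt (hf i)).symm
    _ = ∑ s ∈ range N, ∑ i ∈ dyadicLevel z s, f i := by
        rw [← sum_fiberwise_of_maps_to hlevel]
        simp only [filter_filter, dyadicLevel]

theorem sum_sum_eq_sum_dyadicLevel {M : Type*} [AddCommMonoid M]
    (hN : ∀ i, (z i).natAbs < 2 ^ N) (f : ι → ι → M)
    (hf : ∀ i j, z i = 0 ∨ z j = 0 → f i j = 0) :
    ∑ i, ∑ j, f i j =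
      ∑ s ∈ range N, ∑ t ∈ range N, ∑ i ∈ dyadicLevel z s, ∑ j ∈ dyadicLevel z t, f i j := by
  rw [sum_eq_sum_dyadicLevel hN (fun i => ∑ j, f i j) fun i hi =>
    sum_eq_zero fun j _ => hf i j (Or.inl hi)]
  refine sum_congr rfl fun s _ => ?_
  exact (sum_congr rfl fun i _ =>
    sum_eq_sum_dyadicLevel hN (f i) fun j hj => hf i j (Or.inr hj)).trans sum_comm

theorem sum_card_dyadicLevel_mul_four_pow_le (hN : ∀ i, (z i).natAbs < 2 ^ N) :
    ∑ s ∈ range N, (#(dyadicLevel z s) : ℝ) * 4 ^ s ≤ ∑ i, (z i : ℝ) ^ 2 := by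
  rw [sum_eq_sum_dyadicLevel hN _ fun i hi => by simp [hi]]
  refine sum_le_sum fun s _ => ?_
  rw [← nsmul_eq_mul]
  refine card_nsmul_le_sum _ _ _ fun i hi => ?_
  rw [← sq_abs, show (4 : ℝ) = 2 ^ 2 by norm_num, ← pow_mul, mul_comm, pow_mul]
  have := two_pow_le_abs_of_mem_dyadicLevel hi
  gcongr

theorem natAbs_lt_two_pow_of_sum_sq_le {n : ℕ} (hz : ∑ i, z i ^ 2 ≤ 16 * n) (i : ι) :
    (z i).natAbs < 2 ^ (n + 3) := by
  have hsq : z i ^ 2 ≤ 16 * n :=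
    (single_le_sum (f := fun i => z i ^ 2) (fun _ _ => sq_nonneg _) (mem_univ i)).trans hz
  have hpow : (n : ℤ) < 2 ^ n := by exact_mod_cast Nat.lt_two_pow_self
  have h : |z i| < 2 ^ (n + 3) := by
    refine abs_lt_of_sq_lt_sq ?_ (by positivity)
    calc z i ^ 2 < 16 * 2 ^ n := by linarith
      _ ≤ 16 * 2 ^ n * (4 * 2 ^ n) := le_mul_of_one_le_right (by positivity)
          (one_le_mul_of_one_le_of_one_le (by norm_num) (one_le_pow₀ one_le_two))
      _ = (2 ^ (n + 3)) ^ 2 := by ring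
  zify
  exact h

theorem abs_sub_lightPart_le_of_mem_dyadicLevel {θ : ℝ} {L : ℕ} (hL : 2 ^ (L + 1) ≤ θ)
    (hi : i ∈ dyadicLevel z s) (hj : j ∈ dyadicLevel z t) :
    |(z i * z j : ℝ) - lightPart θ (z i * z j)| ≤ 4 * if L ≤ s + t then 2 ^ (s + t) else 0 := by
  have hlt : |(z i * z j : ℝ)| < 2 ^ (s + t + 2) := by
    rw [abs_mul, show s + t + 2 = (s + 1) + (t + 1) by omega, pow_add]
    exact mul_lt_mul'' (abs_lt_two_pow_of_mem_dyadicLevel hi)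
      (abs_lt_two_pow_of_mem_dyadicLevel hj) (abs_nonneg _) (abs_nonneg _)
  by_cases hlight : |(z i * z j : ℝ)| ≤ θ
  · rw [lightPart, if_pos hlight, sub_self, abs_zero]
    positivity
  · have hL : (2 : ℝ) ^ (L + 1) < 2 ^ (s + t + 2) := hL.trans_lt ((not_le.1 hlight).trans hlt)
    have : L ≤ s + t := by
      have := (pow_lt_pow_iff_right₀ one_lt_two).1 hL
      omega
    rw [lightPart, if_neg hlight, sub_zero, if_pos this]
    exact hlt.le.trans_eq (by ring)

end DyadicLevels

section HeavyPairs

variable {n : ℕ} {A A' : Matrix (Fin n) (Fin n) ℝ} {d : ℝ}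

theorem IsDegreeRegularization.edgeCount_le (h : IsDegreeRegularization A d A')
    (S T : Finset (Fin n)) : ∑ i ∈ S, ∑ j ∈ T, A' i j ≤ d * #S := by
  calc ∑ i ∈ S, ∑ j ∈ T, A' i j ≤ ∑ i ∈ S, weightedDegree A' i :=
        sum_le_sum fun i _ => sum_le_sum_of_subset_of_nonneg (subset_univ _)
          fun j _ _ => h.nonneg i j
    _ ≤ ∑ _i ∈ S, d := sum_le_sum fun i _ => h.degree_le i
    _ = d * #S := by rw [sum_const, nsmul_eq_mul, mul_comm]

theorem IsDegreeRegularization.edgeCount_le' (h : IsDegreeRegularization A d A')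
    (S T : Finset (Fin n)) : ∑ i ∈ S, ∑ j ∈ T, A' i j ≤ d * #T := by
  refine sum_comm.trans_le ?_
  simpa only [h.symm.apply] using h.edgeCount_le T S

theorem IsDegreeRegularization.sum_sum_abs_sub_lightPart_le_sum_levels
    (h : IsDegreeRegularization A d A') {θ : ℝ} {L N : ℕ} (hL : 2 ^ (L + 1) ≤ θ) {z : Fin n → ℤ}
    (hN : ∀ i, (z i).natAbs < 2 ^ N) :
    ∑ i, ∑ j, |(z i * z j : ℝ) - lightPart θ (z i * z j)| * A' i j ≤
      4 * ∑ s ∈ range N, ∑ t ∈ range N, if L ≤ s + t then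
        2 ^ (s + t) * ∑ i ∈ dyadicLevel z s, ∑ j ∈ dyadicLevel z t, A' i j else 0 := by
  rw [sum_sum_eq_sum_dyadicLevel hN _ fun i j hij => by
    rcases hij with hi | hj <;> simp [lightPart, *]]
  simp only [mul_sum]
  refine sum_le_sum fun s _ => sum_le_sum fun t _ => ?_
  calc ∑ i ∈ dyadicLevel z s, ∑ j ∈ dyadicLevel z t,
        |(z i * z j : ℝ) - lightPart θ (z i * z j)| * A' i j
      ≤ ∑ i ∈ dyadicLevel z s, ∑ j ∈ dyadicLevel z t,
          (4 * if L ≤ s + t then 2 ^ (s + t) else 0) * A' i j :=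
        sum_le_sum fun i hi => sum_le_sum fun j hj => mul_le_mul_of_nonneg_right
          (abs_sub_lightPart_le_of_mem_dyadicLevel hL hi hj) (h.nonneg i j)
    _ = 4 * if L ≤ s + t then ∑ i ∈ dyadicLevel z s, ∑ j ∈ dyadicLevel z t,
          2 ^ (s + t) * A' i j else 0 := by
        split_ifs <;> simp [mul_sum, mul_assoc]

theorem HasDiscrepancy.sum_sum_abs_sub_lightPart_le {a ρ : ℝ} {L : ℕ}
    (hA : HasDiscrepancy A a ρ L) (h : IsDegreeRegularization A (2 * a) A') (hn : 0 < n)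
    (ha : 0 ≤ a) (hρ : 0 ≤ ρ) (hL : 2 ^ L ≤ √a) (hL' : √a ≤ 2 ^ (L + 1)) {z : Fin n → ℤ}
    (hz : ∑ i, z i ^ 2 ≤ 16 * n) :
    ∑ i, ∑ j, |(z i * z j : ℝ) - lightPart (2 * √a) (z i * z j)| * A' i j ≤
      4 * ((2500 + 400 * ρ) * n * √a) := by
  have hN := natAbs_lt_two_pow_of_sum_sq_le hz
  refine (h.sum_sum_abs_sub_lightPart_le_sum_levels (L := L) ?_ hN).trans ?_
  · rw [pow_succ']
    gcongr
  have : 0 < log 2 := log_pos one_lt_two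
  refine mul_le_mul_of_nonneg_left (sum_levels_two_pow_mul_le hρ (by positivity) ha hL hL'
    (k := fun s => #(dyadicLevel z s)) (fun s => by positivity) ?_
    (fun s t => sum_nonneg fun i _ => sum_nonneg fun j _ => h.nonneg i j)
    (fun s t => h.edgeCount_le _ _) (fun s t => h.edgeCount_le' _ _)
    fun s hs t ht hst => ?_) zero_le_four
  · exact (sum_card_dyadicLevel_mul_four_pow_le hN).trans (by exact_mod_cast hz)
  · refine le_trans ?_ (hA s hs t ht hst _ _)
    gcongr
    exact h.le _ _

end HeavyPairs

section QuadraticForm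

theorem abs_lightPart_le_abs (θ x : ℝ) : |lightPart θ x| ≤ |x| :=
  sq_le_sq.1 (lightPart_sq_le θ x)

theorem abs_sub_lightPart_le {θ : ℝ} (hθ : 0 < θ) (x : ℝ) : |x - lightPart θ x| ≤ x ^ 2 / θ := by
  unfold lightPart
  split_ifs with hx
  · rw [sub_self, abs_zero]
    positivity
  · rw [sub_zero, le_div_iff₀ hθ, ← sq_abs x, sq]
    gcongr
    exact (not_le.1 hx).le

theorem sum_sum_abs_sub_lightPart_mul_le {ι : Type*} [Fintype ι] {θ p : ℝ} (hθ : 0 < θ)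
    (hp : 0 ≤ p) {M : Matrix ι ι ℝ} (hM : ∀ i j, M i j ≤ p) (x : ι → ℝ) :
    ∑ i, ∑ j, |x i * x j - lightPart θ (x i * x j)| * M i j ≤ (∑ i, x i ^ 2) ^ 2 / θ * p := by
  calc ∑ i, ∑ j, |x i * x j - lightPart θ (x i * x j)| * M i j
      ≤ ∑ i, ∑ j, x i ^ 2 * x j ^ 2 / θ * p := by
        refine sum_le_sum fun i _ => sum_le_sum fun j _ =>
          (mul_le_mul_of_nonneg_left (hM i j) (abs_nonneg _)).trans
            (mul_le_mul_of_nonneg_right ?_ hp)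
        rw [← mul_pow]
        exact abs_sub_lightPart_le hθ _
    _ = (∑ i, x i ^ 2) ^ 2 / θ * p := by
        rw [sq (∑ i, x i ^ 2), sum_mul_sum]
        simp only [sum_div, sum_mul]

theorem sum_sum_abs_lightPart_mul_sub_le {ι : Type*} [Fintype ι] {P M : Matrix ι ι ℝ}
    (hPM : ∀ i j, i ≠ j → P i j = M i j) (hdiag : ∀ i, |P i i - M i i| ≤ 1) (θ : ℝ)
    (x : ι → ℝ) :
    ∑ i, ∑ j, |lightPart θ (x i * x j) * (P i j - M i j)| ≤ ∑ i, x i ^ 2 := by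
  gcongr with i _
  rw [sum_eq_single i (fun j _ hji => by rw [hPM i j hji.symm, sub_self, mul_zero, abs_zero])
    (by simp), abs_mul]
  calc |lightPart θ (x i * x i)| * |P i i - M i i|
      ≤ |x i * x i| * 1 :=
        mul_le_mul (abs_lightPart_le_abs _ _) (hdiag i) (abs_nonneg _) (abs_nonneg _)
    _ = x i ^ 2 := by rw [mul_one, abs_mul_self, sq]

theorem le_twenty_mul_exp_of_two_mul_lt {a x : ℝ} (h : 2 * a < x) :
    x ≤ 20 * exp (x / 2 - 9 / 10 * a) := by
  have hle : x / 20 ≤ exp (x / 20) := by linarith [add_one_le_exp (x / 20)]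
  have hexp : exp (x / 20) ≤ exp (x / 2 - 9 / 10 * a) := exp_le_exp.2 (by linarith)
  linarith

variable {n : ℕ} {A A' P M : Matrix (Fin n) (Fin n) ℝ} {a ρ : ℝ}

theorem HasDegreeTail.sum_highDegree_le (hA : HasDegreeTail A a ρ) :
    ∑ i, (if 2 * a < weightedDegree A i then weightedDegree A i else 0) ≤ 20 * (n * exp ρ) :=
  calc ∑ i, (if 2 * a < weightedDegree A i then weightedDegree A i else 0)
      ≤ ∑ i, 20 * exp (weightedDegree A i / 2 - 9 / 10 * a) := by
        gcongr with i _
        split_ifs with hi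
        · exact le_twenty_mul_exp_of_two_mul_lt hi
        · positivity
    _ ≤ 20 * (n * exp ρ) := by
        rw [← mul_sum]
        exact mul_le_mul_of_nonneg_left hA (by norm_num)

theorem IsDegreeRegularization.sum_sum_sub_le {d : ℝ} (h : IsDegreeRegularization A d A')
    (hA : ∀ i j, 0 ≤ A i j) (hsymm : A.IsSymm) :
    ∑ i, ∑ j, (A i j - A' i j) ≤
      2 * ∑ i, (if d < weightedDegree A i then weightedDegree A i else 0) := by
  have hpoint (i j : Fin n) : A i j - A' i j ≤
      (if d < weightedDegree A i then A i j else 0) +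
        (if d < weightedDegree A j then A j i else 0) := by
    have hA' := h.nonneg i j
    have hij := hA i j
    rw [hsymm.apply i j]
    split_ifs with hi hj hj
    any_goals linarith
    linarith [h.eq_of_degree_le i j (not_lt.1 hi) (not_lt.1 hj)]
  have hrow (i : Fin n) : ∑ j, (if d < weightedDegree A i then A i j else 0) =
      if d < weightedDegree A i then weightedDegree A i else 0 := by
    split_ifs <;> simp [weightedDegree]
  calc ∑ i, ∑ j, (A i j - A' i j)
      ≤ ∑ i, ∑ j, ((if d < weightedDegree A i then A i j else 0) +
          (if d < weightedDegree A j then A j i else 0)) := by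
        gcongr with i _ j _
        exact hpoint i j
    _ = 2 * ∑ i, (if d < weightedDegree A i then weightedDegree A i else 0) := by
        simp only [sum_add_distrib]
        rw [sum_comm (f := fun i j => if d < weightedDegree A j then A j i else 0), ← two_mul]
        simp only [hrow]

theorem abs_mul_sub_sub_mul_sub_le {x l θ α α' p m : ℝ} (hl : |l| ≤ θ) (hα' : 0 ≤ α')
    (hα : α' ≤ α) (hm : 0 ≤ m) :
    |x * (α' - m) - l * (α - p)| ≤
      θ * (α - α') + |l * (p - m)| + |x - l| * α' + |x - l| * m := by
  have hαα' : 0 ≤ α - α' := sub_nonneg.2 hα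
  calc |x * (α' - m) - l * (α - p)|
      = |-(l * (α - α')) + l * (p - m) + (x - l) * α' - (x - l) * m| := by ring_nf
    _ ≤ |l| * (α - α') + |l * (p - m)| + |x - l| * α' + |x - l| * m := by
        refine (abs_sub _ _).trans ?_
        rw [abs_mul (x - l) m, abs_of_nonneg hm]
        gcongr
        refine (abs_add_le _ _).trans ?_
        rw [abs_mul (x - l) α', abs_of_nonneg hα']
        gcongr
        refine (abs_add_le _ _).trans_eq ?_
        rw [abs_neg, abs_mul l (α - α'), abs_of_nonneg hαα']
    _ ≤ _ := by gcongr

theorem IsDegreeRegularization.abs_sum_sum_mul_sub_le {d θ : ℝ}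
    (h : IsDegreeRegularization A d A') (hθ : 0 ≤ θ) (hM : ∀ i j, 0 ≤ M i j) (x : Fin n → ℝ) :
    |∑ i, ∑ j, x i * x j * (A' i j - M i j)| ≤
      |∑ i, ∑ j, lightPart θ (x i * x j) * (A i j - P i j)| +
      (θ * ∑ i, ∑ j, (A i j - A' i j) +
        ∑ i, ∑ j, |lightPart θ (x i * x j) * (P i j - M i j)| +
        ∑ i, ∑ j, |x i * x j - lightPart θ (x i * x j)| * A' i j +
        ∑ i, ∑ j, |x i * x j - lightPart θ (x i * x j)| * M i j) := by
  set l : Fin n → Fin n → ℝ := fun i j => lightPart θ (x i * x j)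
  have hdiff : |∑ i, ∑ j, (x i * x j * (A' i j - M i j) - l i j * (A i j - P i j))| ≤
      ∑ i, ∑ j, (θ * (A i j - A' i j) + |l i j * (P i j - M i j)| +
        |x i * x j - l i j| * A' i j + |x i * x j - l i j| * M i j) :=
    (abs_sum_le_sum_abs _ _).trans <| sum_le_sum fun i _ =>
      (abs_sum_le_sum_abs _ _).trans <| sum_le_sum fun j _ =>
        abs_mul_sub_sub_mul_sub_le (abs_lightPart_le hθ _) (h.nonneg i j) (h.le i j) (hM i j)
  simp only [sum_sub_distrib, sum_add_distrib, ← mul_sum] at hdiff ⊢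
  linarith [abs_sub_abs_le_abs_sub (∑ i, ∑ j, x i * x j * (A' i j - M i j))
    (∑ i, ∑ j, l i j * (A i j - P i j))]

/-- The factor in the bound for the quadratic form of `A' - M` in terms of the confidence
parameter `ρ`; it is linear up to the contribution of the vertices of large degree. -/
noncomputable def deviationConstant (ρ : ℝ) : ℝ := 10400 + 1610 * ρ + 80 * exp ρ

theorem IsDegreeRegularization.abs_quadraticForm_sub_le {L : ℕ}
    (h : IsDegreeRegularization A (2 * a) A') (hA : ∀ i j, 0 ≤ A i j) (hsymm : A.IsSymm)
    (hlight : HasLightBound (A - P) a ρ) (hdisc : HasDiscrepancy A a ρ L)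
    (htail : HasDegreeTail A a ρ) (hPM : ∀ i j, i ≠ j → P i j = M i j)
    (hdiag : ∀ i, |P i i - M i i| ≤ 1) (hM : ∀ i j, 0 ≤ M i j) (hMa : ∀ i j, M i j ≤ a / n)
    (hn : 0 < n) (ha : 1 ≤ a) (hρ : 0 ≤ ρ) (hL : 2 ^ L ≤ √a) (hL' : √a ≤ 2 ^ (L + 1))
    {z : Fin n → ℤ} (hz : ∑ i, z i ^ 2 ≤ 16 * n) :
    |∑ i, ∑ j, (z i * z j : ℝ) * (A' i j - M i j)| ≤ deviationConstant ρ * n * √a := by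
  have hz' : ∑ i, (z i : ℝ) ^ 2 ≤ 16 * n := by exact_mod_cast hz
  have hremoved : 2 * √a * ∑ i, ∑ j, (A i j - A' i j) ≤ 2 * √a * (2 * (20 * (n * exp ρ))) := by
    gcongr
    exact (h.sum_sum_sub_le hA hsymm).trans
      (mul_le_mul_of_nonneg_left htail.sum_highDegree_le zero_le_two)
  have hdiagonal : ∑ i, ∑ j, |lightPart (2 * √a) (z i * z j) * (P i j - M i j)| ≤ 16 * n * √a :=
    (sum_sum_abs_lightPart_mul_sub_le hPM hdiag _ fun i => (z i : ℝ)).trans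
      (hz'.trans (le_mul_of_one_le_right (by positivity) (one_le_sqrt.2 ha)))
  have hheavy := hdisc.sum_sum_abs_sub_lightPart_le h hn (by linarith) hρ hL hL' hz
  have hheavyM : ∑ i, ∑ j, |(z i * z j : ℝ) - lightPart (2 * √a) (z i * z j)| * M i j ≤
      128 * n * √a := by
    refine (sum_sum_abs_sub_lightPart_mul_le (by positivity) (by positivity) hMa _).trans ?_
    calc (∑ i, (z i : ℝ) ^ 2) ^ 2 / (2 * √a) * (a / n)
        ≤ (16 * n) ^ 2 / (2 * √a) * (a / n) := by gcongr
      _ = 128 * n * √a := by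
          have : √a * √a = a := mul_self_sqrt (by positivity)
          field_simp
          linear_combination (-256) * this
  have hmain := h.abs_sum_sum_mul_sub_le (P := P) (θ := 2 * √a) (by positivity) hM
    fun i => (z i : ℝ)
  have hsum := add_le_add (hlight z hz)
    (add_le_add (add_le_add (add_le_add hremoved hdiagonal) hheavy) hheavyM)
  refine hmain.trans (hsum.trans ?_)
  have : 0 ≤ ρ * (n * √a) := by positivity
  have : 0 ≤ n * √a := by positivity
  unfold deviationConstant
  linarith

end QuadraticForm

section IntegerNet

open scoped RealInnerProductSpace

theorem exists_int_abs_le_abs_and_abs_sub_le_one (y : ℝ) :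
    ∃ z : ℤ, |(z : ℝ)| ≤ |y| ∧ |y - z| ≤ 1 := by
  wlog hy : 0 ≤ y generalizing y
  · obtain ⟨z, hz, hyz⟩ := this (-y) (by linarith)
    refine ⟨-z, by simpa using hz, ?_⟩
    rw [← abs_neg]
    simpa [sub_eq_add_neg, add_comm] using hyz
  · refine ⟨⌊y⌋, ?_, ?_⟩
    · rw [abs_of_nonneg hy, abs_of_nonneg (by exact_mod_cast Int.floor_nonneg.2 hy)]
      exact Int.floor_le y
    · rw [abs_of_nonneg (sub_nonneg.2 (Int.floor_le y))]
      linarith [Int.lt_floor_add_one y]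

section Operator

variable {E : Type*} [NormedAddCommGroup E] [InnerProductSpace ℝ E]
  {T : E →L[ℝ] E} {K : ℝ}

theorem norm_le_of_abs_inner_apply_self_le (hT : T.IsSymmetric) (hK : 0 ≤ K)
    (h : ∀ x, ‖x‖ = 1 → |⟪T x, x⟫| ≤ K) : ‖T‖ ≤ K := by
  rw [T.norm_eq_iSup_rayleighQuotient hT]
  refine ciSup_le fun x => ?_
  obtain rfl | hx := eq_or_ne x 0
  · rwa [ContinuousLinearMap.rayleighQuotient_apply_zero, abs_zero]
  · have hunit : ‖‖x‖⁻¹ • x‖ = 1 := norm_smul_inv_norm (𝕜 := ℝ) hx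
    rw [← T.rayleigh_smul x (c := ‖x‖⁻¹) (inv_ne_zero (norm_ne_zero_iff.2 hx)),
      ContinuousLinearMap.rayleighQuotient, hunit, one_pow, div_one]
    exact h _ hunit

theorem abs_inner_apply_self_le_add {x x' : E} (hx : ‖x‖ ≤ 1) (hx' : ‖x'‖ ≤ 1) {δ : ℝ}
    (hxx' : ‖x - x'‖ ≤ δ) :
    |⟪T x, x⟫| ≤ |⟪T x', x'⟫| + 2 * δ * ‖T‖ := by
  have hsplit : ⟪T x, x⟫ = ⟪T x', x'⟫ + ⟪T (x - x'), x⟫ + ⟪T x', x - x'⟫ := by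
    simp only [map_sub, inner_sub_left, inner_sub_right]
    ring
  have hfirst : |⟪T (x - x'), x⟫| ≤ ‖T‖ * δ * 1 := by
    refine (abs_real_inner_le_norm _ _).trans ?_
    exact mul_le_mul (T.le_opNorm_of_le hxx') hx (norm_nonneg _)
      (mul_nonneg (norm_nonneg _) ((norm_nonneg _).trans hxx'))
  have hsecond : |⟪T x', x - x'⟫| ≤ ‖T‖ * 1 * δ := by
    refine (abs_real_inner_le_norm _ _).trans ?_
    gcongr
    exact T.le_opNorm_of_le hx'
  rw [hsplit]
  linarith [abs_add_le (⟪T x', x'⟫ + ⟪T (x - x'), x⟫) ⟪T x', x - x'⟫,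
    abs_add_le ⟪T x', x'⟫ ⟪T (x - x'), x⟫]

theorem norm_le_two_mul_of_quarter_net (hT : T.IsSymmetric) (hK : 0 ≤ K)
    (h : ∀ x, ‖x‖ = 1 → ∃ x', ‖x'‖ ≤ 1 ∧ ‖x - x'‖ ≤ 1 / 4 ∧ |⟪T x', x'⟫| ≤ K) :
    ‖T‖ ≤ 2 * K := by
  have : ‖T‖ ≤ K + 2 * (1 / 4) * ‖T‖ :=
    norm_le_of_abs_inner_apply_self_le hT (by positivity) fun x hx => by
      obtain ⟨x', hx', hxx', hTx'⟩ := h x hx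
      exact (abs_inner_apply_self_le_add hx.le hx' hxx').trans (by gcongr)
  linarith

end Operator

variable {n : ℕ}

theorem sq_four_mul_sqrt (n : ℕ) : (4 * √n) ^ 2 = 16 * (n : ℝ) := by
  rw [mul_pow, sq_sqrt n.cast_nonneg]
  norm_num

theorem exists_int_net_point (hn : 0 < n) {x : EuclideanSpace ℝ (Fin n)} (hx : ‖x‖ = 1) :
    ∃ z : Fin n → ℤ, ∑ i, z i ^ 2 ≤ 16 * n ∧
      ‖x - WithLp.toLp 2 fun i => z i / (4 * √n)‖ ≤ 1 / 4 := by
  have : (0 : ℝ) < n := by exact_mod_cast hn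
  choose z hz hxz using fun i => exists_int_abs_le_abs_and_abs_sub_le_one (4 * √n * x i)
  refine ⟨z, ?_, ?_⟩
  · have : ∑ i, (z i : ℝ) ^ 2 ≤ 16 * n := by
      calc ∑ i, (z i : ℝ) ^ 2 ≤ ∑ i, (4 * √n) ^ 2 * x i ^ 2 := by
            gcongr with i _
            rw [← mul_pow]
            exact sq_le_sq.2 (hz i)
        _ = 16 * n := by
            rw [← mul_sum, sq_four_mul_sqrt, ← EuclideanSpace.real_norm_sq_eq, hx, one_pow, mul_one]
    exact_mod_cast this
  · refine (pow_le_pow_iff_left₀ (norm_nonneg _) (by norm_num) two_ne_zero).1 ?_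
    rw [EuclideanSpace.real_norm_sq_eq]
    calc ∑ i, (x i - z i / (4 * √n)) ^ 2 ≤ ∑ i : Fin n, 1 / (16 * (n : ℝ)) := by
          gcongr with i _
          rw [show x i - z i / (4 * √n) = (4 * √n * x i - z i) / (4 * √n) by field_simp, div_pow,
            sq_four_mul_sqrt]
          gcongr
          exact (sq_le_one_iff_abs_le_one _).2 (hxz i)
      _ = (1 / 4) ^ 2 := by
          rw [sum_const, card_univ, Fintype.card_fin, nsmul_eq_mul]
          field_simp
          norm_num

theorem norm_toEuclideanCLM_le_of_int (hn : 0 < n) {B : Matrix (Fin n) (Fin n) ℝ}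
    (hB : B.IsSymm) {κ : ℝ} (h : ∀ z : Fin n → ℤ, ∑ i, z i ^ 2 ≤ 16 * n →
      |∑ i, ∑ j, (z i * z j : ℝ) * B i j| ≤ κ * n) :
    ‖Matrix.toEuclideanCLM (𝕜 := ℝ) B‖ ≤ κ / 8 := by
  have hn' : (0 : ℝ) < n := by exact_mod_cast hn
  have hκ : 0 ≤ κ := nonneg_of_mul_nonneg_left ((abs_nonneg _).trans (h 0 (by simp))) hn'
  have hsymm : (Matrix.toEuclideanCLM (𝕜 := ℝ) B).IsSymmetric :=
    Matrix.isSymmetric_toEuclideanLin_iff.2 (by rwa [Matrix.IsHermitian,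
      Matrix.conjTranspose_eq_transpose_of_trivial])
  rw [show κ / 8 = 2 * (κ / 16) by ring]
  refine norm_le_two_mul_of_quarter_net hsymm (by positivity) fun x hx => ?_
  obtain ⟨z, hz, hxz⟩ := exists_int_net_point hn hx
  set x' : EuclideanSpace ℝ (Fin n) := WithLp.toLp 2 fun i => z i / (4 * √n)
  have hx' : ‖x'‖ ≤ 1 := by
    rw [← sq_le_one_iff₀ (norm_nonneg _), EuclideanSpace.real_norm_sq_eq]
    simp only [x', div_pow, sq_four_mul_sqrt, ← sum_div]
    exact (div_le_one (by positivity)).2 (by exact_mod_cast hz)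
  refine ⟨x', hx', hxz, ?_⟩
  have hform : ⟪Matrix.toEuclideanCLM (𝕜 := ℝ) B x', x'⟫ =
      (∑ i, ∑ j, (z i * z j : ℝ) * B i j) / (16 * n) := by
    rw [real_inner_comm, Matrix.inner_toEuclideanCLM, ← sq_four_mul_sqrt]
    simp only [x', dotProduct, Matrix.mulVec, sum_div, mul_sum]
    refine sum_congr rfl fun i _ => sum_congr rfl fun j _ => ?_
    field_simp
  rw [hform, abs_div, abs_of_pos (show (0 : ℝ) < 16 * n by positivity),
    div_le_iff₀ (by positivity)]
  linarith [h z hz]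

end IntegerNet

section Communities

open scoped RealInnerProductSpace

variable {n : ℕ} {c : Fin n → Bool}

theorem sum_bool_eq_add_not {M : Type*} [AddCommMonoid M] (f : Bool → M) (τ : Bool) :
    ∑ σ, f σ = f τ + f (!τ) := by
  cases τ <;> simp [add_comm]

theorem IsBalanced.card_community (hc : IsBalanced c) (τ : Bool) :
    (#{i | c i = τ} : ℝ) = n / 2 := by
  have heq : #{i | c i = true} = #{i | c i = false} := by
    simpa [IsBalanced, Set.ncard_eq_toFinset_card'] using hc
  have hsum : #{i | c i = true} + #{i | c i = false} = n := by
    simpa using card_filter_add_card_filter_not (s := univ) fun i => c i = true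
  have : (#{i | c i = true} : ℝ) = #{i | c i = false} := by exact_mod_cast heq
  have : (#{i | c i = true} + #{i | c i = false} : ℝ) = n := by exact_mod_cast hsum
  cases τ <;> linarith

/-- The indicator of a community, normalized to a unit vector when the communities are balanced. -/
noncomputable def communityVec (c : Fin n → Bool) (τ : Bool) : EuclideanSpace ℝ (Fin n) :=
  WithLp.toLp 2 fun i => if c i = τ then (√(n / 2))⁻¹ else 0

/-- The coefficient of a vector along the normalized indicator of a community. -/
noncomputable def communityCoeff (c : Fin n → Bool) (τ : Bool)
    (x : EuclideanSpace ℝ (Fin n)) : ℝ :=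
  ⟪communityVec c τ, x⟫

/-- The part of a vector that is orthogonal to the indicators of both communities. -/
noncomputable def communityResidual (c : Fin n → Bool) (x : EuclideanSpace ℝ (Fin n)) :
    EuclideanSpace ℝ (Fin n) :=
  x - ∑ σ, communityCoeff c σ x • communityVec c σ

theorem communityCoeff_eq_sum (τ : Bool) (x : EuclideanSpace ℝ (Fin n)) :
    communityCoeff c τ x = (√(n / 2))⁻¹ * ∑ i with c i = τ, x i := by
  simp [communityCoeff, communityVec, PiLp.inner_apply, sum_filter, mul_sum, mul_comm]

theorem communityCoeff_nonneg {x : EuclideanSpace ℝ (Fin n)} (hx : ∀ i, 0 ≤ x i) (τ : Bool) :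
    0 ≤ communityCoeff c τ x := by
  rw [communityCoeff_eq_sum]
  exact mul_nonneg (by positivity) (sum_nonneg fun i _ => hx i)

theorem communityCoeff_neg (τ : Bool) (x : EuclideanSpace ℝ (Fin n)) :
    communityCoeff c τ (-x) = -communityCoeff c τ x :=
  inner_neg_right _ _

theorem communityResidual_apply (x : EuclideanSpace ℝ (Fin n)) (i : Fin n) :
    communityResidual c x i = x i - communityCoeff c (c i) x * (√(n / 2))⁻¹ := by
  rw [communityResidual, sum_bool_eq_add_not _ (c i)]
  simp [communityVec]

variable [NeZero n]

theorem half_pos_of_neZero : (0 : ℝ) < n / 2 := by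
  have : (0 : ℝ) < n := by exact_mod_cast NeZero.pos n
  positivity

theorem IsBalanced.orthonormal_communityVec (hc : IsBalanced c) :
    Orthonormal ℝ (communityVec c) := by
  rw [orthonormal_iff_ite]
  intro σ τ
  change communityCoeff c σ (communityVec c τ) = _
  simp only [communityCoeff_eq_sum, communityVec]
  split_ifs with h
  · rw [h, sum_congr rfl fun i hi => if_pos (mem_filter.1 hi).2, sum_const, nsmul_eq_mul,
      hc.card_community, mul_left_comm, ← mul_inv, mul_self_sqrt half_pos_of_neZero.le,
      mul_inv_cancel₀ half_pos_of_neZero.ne']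
  · rw [sum_eq_zero fun i hi => if_neg fun hi' => h ((mem_filter.1 hi).2.symm.trans hi'), mul_zero]

theorem IsBalanced.communityCoeff_communityVec (hc : IsBalanced c) (σ τ : Bool) :
    communityCoeff c σ (communityVec c τ) = if σ = τ then 1 else 0 :=
  orthonormal_iff_ite.1 hc.orthonormal_communityVec σ τ

theorem IsBalanced.communityCoeff_sum (hc : IsBalanced c) (w : Bool → ℝ) (τ : Bool) :
    communityCoeff c τ (∑ σ, w σ • communityVec c σ) = w τ :=
  hc.orthonormal_communityVec.inner_right_fintype w τ

theorem IsBalanced.communityCoeff_communityResidual (hc : IsBalanced c) (τ : Bool)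
    (x : EuclideanSpace ℝ (Fin n)) : communityCoeff c τ (communityResidual c x) = 0 := by
  rw [communityResidual, communityCoeff, inner_sub_right]
  exact sub_eq_zero.2 (hc.communityCoeff_sum (fun σ => communityCoeff c σ x) τ).symm

theorem IsBalanced.inner_eq (hc : IsBalanced c) (x y : EuclideanSpace ℝ (Fin n)) :
    ⟪x, y⟫ = ∑ σ, communityCoeff c σ x * communityCoeff c σ y +
      ⟪communityResidual c x, communityResidual c y⟫ := by
  have horth : ⟪∑ σ, communityCoeff c σ x • communityVec c σ, communityResidual c y⟫ = 0 := by
    rw [sum_inner]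
    refine sum_eq_zero fun σ _ => ?_
    rw [inner_smul_left, ← communityCoeff, hc.communityCoeff_communityResidual, mul_zero]
  conv_rhs => rw [communityResidual, inner_sub_left, horth, sub_zero, communityResidual,
    inner_sub_right, inner_sum]
  simp only [inner_smul_right, communityCoeff, real_inner_comm x]
  rw [sum_congr rfl fun σ _ => mul_comm _ _, add_sub_cancel]

theorem IsBalanced.norm_sq_eq (hc : IsBalanced c) (x : EuclideanSpace ℝ (Fin n)) :
    ‖x‖ ^ 2 = ∑ σ, communityCoeff c σ x ^ 2 + ‖communityResidual c x‖ ^ 2 := by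
  rw [← real_inner_self_eq_norm_sq, hc.inner_eq, real_inner_self_eq_norm_sq]
  simp only [sq]

theorem IsBalanced.abs_communityCoeff_le (hc : IsBalanced c) (τ : Bool)
    (x : EuclideanSpace ℝ (Fin n)) : |communityCoeff c τ x| ≤ ‖x‖ := by
  have h := abs_real_inner_le_norm (communityVec c τ) x
  rwa [hc.orthonormal_communityVec.1 τ, one_mul] at h

/-- Vertices of the community `τ` at which `x` vanishes or has the sign opposite to its mean over
that community. -/
noncomputable def wrongSign (c : Fin n → Bool) (x : EuclideanSpace ℝ (Fin n)) (τ : Bool) :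
    Finset (Fin n) :=
  {i | c i = τ ∧ x i * communityCoeff c τ x ≤ 0}

theorem card_wrongSign_mul_le (x : EuclideanSpace ℝ (Fin n)) (τ : Bool) :
    #(wrongSign c x τ) * communityCoeff c τ x ^ 2 ≤ n / 2 * ‖communityResidual c x‖ ^ 2 := by
  set y := communityCoeff c τ x
  have hpoint : ∀ i ∈ wrongSign c x τ, y ^ 2 * (n / 2 : ℝ)⁻¹ ≤ communityResidual c x i ^ 2 := by
    intro i hi
    obtain ⟨rfl, hxi⟩ : c i = τ ∧ x i * y ≤ 0 := (mem_filter.1 hi).2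
    have hsqrt : ((√(n / 2 : ℝ))⁻¹) ^ 2 = (n / 2 : ℝ)⁻¹ := by
      rw [inv_pow, sq_sqrt half_pos_of_neZero.le]
    have : x i * y * (√(n / 2 : ℝ))⁻¹ ≤ 0 := mul_nonpos_of_nonpos_of_nonneg hxi (by positivity)
    rw [communityResidual_apply, ← hsqrt]
    linarith [sq_nonneg (x i)]
  have hsum : #(wrongSign c x τ) * (y ^ 2 * (n / 2 : ℝ)⁻¹) ≤ ‖communityResidual c x‖ ^ 2 := by
    rw [EuclideanSpace.real_norm_sq_eq, ← nsmul_eq_mul]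
    exact (card_nsmul_le_sum _ _ _ hpoint).trans
      (sum_le_sum_of_subset_of_nonneg (subset_univ _) fun _ _ _ => sq_nonneg _)
  rwa [← mul_assoc, mul_inv_le_iff₀ half_pos_of_neZero, mul_comm (‖_‖ ^ 2)] at hsum

theorem card_wrongSign_le {x : EuclideanSpace ℝ (Fin n)} {τ : Bool} {y θ : ℝ} (hy : 0 < y)
    (hx : y ≤ communityCoeff c τ x ^ 2) (hθ : ‖communityResidual c x‖ ^ 2 ≤ θ * y) :
    #(wrongSign c x τ) ≤ θ * (n / 2 : ℝ) := by
  refine le_of_mul_le_mul_right ?_ hy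
  calc #(wrongSign c x τ) * y ≤ #(wrongSign c x τ) * communityCoeff c τ x ^ 2 := by gcongr
    _ ≤ n / 2 * ‖communityResidual c x‖ ^ 2 := card_wrongSign_mul_le x τ
    _ ≤ n / 2 * (θ * y) := by gcongr
    _ = θ * (n / 2) * y := by ring

end Communities

section BlockMatrix

open scoped RealInnerProductSpace

variable {n : ℕ} {c : Fin n → Bool}

/-- The matrix with entries `p` within the communities of `c` and `q` across them. With `p = a / n`
and `q = b / n` it is the expected adjacency matrix of the planted partition model except on the
diagonal, which carries `p` here so that the matrix has rank at most two. -/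
def blockMatrix (c : Fin n → Bool) (p q : ℝ) : Matrix (Fin n) (Fin n) ℝ :=
  fun i j => if c i = c j then p else q

theorem isSymm_blockMatrix (p q : ℝ) : (blockMatrix c p q).IsSymm := by
  ext i j
  simp only [Matrix.transpose_apply, blockMatrix, eq_comm]

theorem blockMatrix_nonneg {p q : ℝ} (hp : 0 ≤ p) (hq : 0 ≤ q) (i j : Fin n) :
    0 ≤ blockMatrix c p q i j :=
  ite_nonneg hp hq

theorem blockMatrix_le {p q : ℝ} (hqp : q ≤ p) (i j : Fin n) : blockMatrix c p q i j ≤ p := by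
  rw [blockMatrix]
  split_ifs
  exacts [le_rfl, hqp]

/-- The bilinear form of `blockMatrix c (a / n) (b / n)` in the coefficients of the two vectors
along the communities. -/
noncomputable def blockForm (c : Fin n → Bool) (a b : ℝ) (x y : EuclideanSpace ℝ (Fin n)) : ℝ :=
  ∑ σ, communityCoeff c σ x * (a / 2 * communityCoeff c σ y + b / 2 * communityCoeff c (!σ) y)

theorem sum_mul_comp_community [NeZero n] (x : EuclideanSpace ℝ (Fin n)) (g : Bool → ℝ) :
    ∑ i, x i * g (c i) = √(n / 2) * ∑ σ, communityCoeff c σ x * g σ := by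
  have hsqrt : √(n / 2 : ℝ) ≠ 0 := (sqrt_pos.2 half_pos_of_neZero).ne'
  rw [← sum_fiberwise univ c, mul_sum]
  refine sum_congr rfl fun σ _ => ?_
  rw [communityCoeff_eq_sum, mul_assoc, mul_inv_cancel_left₀ hsqrt, sum_mul]
  exact sum_congr rfl fun i hi => by rw [(mem_filter.1 hi).2]

theorem inner_blockMatrix [NeZero n] (a b : ℝ) (x y : EuclideanSpace ℝ (Fin n)) :
    ⟪x, Matrix.toEuclideanCLM (𝕜 := ℝ) (blockMatrix c (a / n) (b / n)) y⟫ =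
      blockForm c a b x y := by
  have hn : (n : ℝ) ≠ 0 := Nat.cast_ne_zero.2 (NeZero.ne n)
  have hmulVec : ∀ i, (blockMatrix c (a / n) (b / n)).mulVec y.ofLp i = √(n / 2) *
      (communityCoeff c (c i) y * (a / n) + communityCoeff c (!c i) y * (b / n)) := by
    intro i
    have := sum_mul_comp_community (c := c) y fun σ => if c i = σ then a / n else b / n
    rw [sum_bool_eq_add_not _ (c i), if_pos rfl, if_neg (by simp)] at this
    simpa only [Matrix.mulVec, dotProduct, blockMatrix, mul_comm] using this
  rw [Matrix.inner_toEuclideanCLM, dotProduct]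
  simp only [hmulVec]
  rw [sum_mul_comp_community x fun σ => √(n / 2) *
    (communityCoeff c σ y * (a / n) + communityCoeff c (!σ) y * (b / n)), mul_sum, blockForm]
  refine sum_congr rfl fun σ _ => ?_
  rw [mul_left_comm _ (√(n / 2)), ← mul_assoc (√(n / 2)), mul_self_sqrt half_pos_of_neZero.le]
  field

/-- An operator that is nonnegative in the sense of matrix entries and lies within distance `β`
of the operator of `blockMatrix c (a / n) (b / n)`. -/
structure IsNearBlock (c : Fin n → Bool) (a b β : ℝ)
    (T : EuclideanSpace ℝ (Fin n) →L[ℝ] EuclideanSpace ℝ (Fin n)) : Prop where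
  nonneg : ∀ x y : EuclideanSpace ℝ (Fin n), (∀ i, 0 ≤ x i) → (∀ i, 0 ≤ y i) → 0 ≤ ⟪x, T y⟫
  abs_sub_le : ∀ x y, |⟪x, T y⟫ - blockForm c a b x y| ≤ β * (‖x‖ * ‖y‖)

variable {a b β : ℝ} {T : EuclideanSpace ℝ (Fin n) →L[ℝ] EuclideanSpace ℝ (Fin n)}

theorem isNearBlock_toEuclideanCLM [NeZero n] {A : Matrix (Fin n) (Fin n) ℝ}
    (hA : ∀ i j, 0 ≤ A i j)
    (hβ : ‖Matrix.toEuclideanCLM (𝕜 := ℝ) (A - blockMatrix c (a / n) (b / n))‖ ≤ β) :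
    IsNearBlock c a b β (Matrix.toEuclideanCLM (𝕜 := ℝ) A) where
  nonneg x y hx hy := by
    rw [Matrix.inner_toEuclideanCLM]
    exact dotProduct_nonneg_of_nonneg hx fun i => dotProduct_nonneg_of_nonneg (hA i) hy
  abs_sub_le x y := by
    rw [← inner_blockMatrix, ← inner_sub_right, ← sub_apply, ← map_sub, mul_left_comm]
    exact (abs_real_inner_le_norm _ _).trans <|
      mul_le_mul_of_nonneg_left (ContinuousLinearMap.le_of_opNorm_le _ hβ y) (norm_nonneg x)

theorem IsNearBlock.inner_le (hT : IsNearBlock c a b β T) (x y : EuclideanSpace ℝ (Fin n)) :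
    ⟪x, T y⟫ ≤ blockForm c a b x y + β * (‖x‖ * ‖y‖) := by
  linarith [(abs_le.1 (hT.abs_sub_le x y)).2]

theorem IsNearBlock.le_inner (hT : IsNearBlock c a b β T) (x y : EuclideanSpace ℝ (Fin n)) :
    blockForm c a b x y - β * (‖x‖ * ‖y‖) ≤ ⟪x, T y⟫ := by
  linarith [(abs_le.1 (hT.abs_sub_le x y)).1]

theorem IsNearBlock.radius_nonneg (hT : IsNearBlock c a b β T) {x : EuclideanSpace ℝ (Fin n)}
    (hx : ‖x‖ = 1) : 0 ≤ β := by
  simpa only [hx, mul_one] using (abs_nonneg _).trans (hT.abs_sub_le x x)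

variable [NeZero n]

theorem IsNearBlock.norm_communityResidual_le (hT : IsNearBlock c a b β T) (hc : IsBalanced c)
    {x : EuclideanSpace ℝ (Fin n)} (hx : ‖x‖ = 1) {lam : ℝ} (hTx : T x = lam • x) :
    lam * ‖communityResidual c x‖ ≤ β := by
  set w := communityResidual c x with hw
  have hcoeff : ∀ σ, communityCoeff c σ w = 0 := fun σ => hc.communityCoeff_communityResidual σ x
  have hww : communityResidual c w = w := by simp [communityResidual, hcoeff]
  have hinner : ⟪w, T x⟫ = lam * ‖w‖ * ‖w‖ := by
    rw [hTx, inner_smul_right, hc.inner_eq, hww, ← hw, real_inner_self_eq_norm_mul_norm]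
    simp [hcoeff, mul_assoc]
  have hle : lam * ‖w‖ * ‖w‖ ≤ β * ‖w‖ := by
    simpa [hinner, hx, blockForm, hcoeff] using hT.inner_le w x
  rcases (norm_nonneg w).eq_or_lt with hzero | hpos
  · rw [← hzero, mul_zero]
    exact hT.radius_nonneg hx
  · exact le_of_mul_le_mul_right hle hpos

end BlockMatrix

section NegativePart

open scoped RealInnerProductSpace

variable {n : ℕ} {c : Fin n → Bool}

/-- The entrywise negative part of a vector, restricted to the community `τ`. -/
noncomputable def communityNegPart (c : Fin n → Bool) (τ : Bool) (v : EuclideanSpace ℝ (Fin n)) :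
    EuclideanSpace ℝ (Fin n) :=
  WithLp.toLp 2 fun i => if c i = τ then (v i)⁻ else 0

theorem communityNegPart_nonneg (τ : Bool) (v : EuclideanSpace ℝ (Fin n)) (i : Fin n) :
    0 ≤ communityNegPart c τ v i :=
  ite_nonneg (negPart_nonneg _) le_rfl

theorem communityCoeff_communityNegPart_not (τ : Bool) (v : EuclideanSpace ℝ (Fin n)) :
    communityCoeff c (!τ) (communityNegPart c τ v) = 0 := by
  rw [communityCoeff_eq_sum, sum_eq_zero, mul_zero]
  intro i hi
  simp [communityNegPart, (mem_filter.1 hi).2]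

theorem inner_communityNegPart_self (τ : Bool) (v : EuclideanSpace ℝ (Fin n)) :
    ⟪communityNegPart c τ v, v⟫ = -‖communityNegPart c τ v‖ ^ 2 := by
  rw [EuclideanSpace.real_norm_sq_eq, ← sum_neg_distrib, PiLp.inner_apply]
  refine sum_congr rfl fun i _ => ?_
  simp only [communityNegPart, RCLike.inner_apply, conj_trivial]
  split_ifs
  · rcases le_total 0 (v i) with hv | hv
    · simp [negPart_eq_zero.2 hv]
    · rw [negPart_of_nonpos hv]
      ring
  · simp

theorem eq_posPart_sub_communityNegPart (τ : Bool) (v : EuclideanSpace ℝ (Fin n)) :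
    v = WithLp.toLp 2 (fun i => (v i)⁺) - communityNegPart c τ v - communityNegPart c (!τ) v := by
  ext i
  obtain h | h : c i = τ ∨ c i = !τ := by cases c i <;> cases τ <;> simp
  all_goals simp [communityNegPart, h, posPart_sub_negPart]

theorem nonneg_of_communityNegPart_eq_zero {v : EuclideanSpace ℝ (Fin n)}
    (hv : ∀ τ, communityNegPart c τ v = 0) (i : Fin n) : 0 ≤ v i := by
  have : communityNegPart c (c i) v i = 0 := by simp [hv]
  simpa [communityNegPart] using this

variable {a b β lam θ : ℝ} {T : EuclideanSpace ℝ (Fin n) →L[ℝ] EuclideanSpace ℝ (Fin n)}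
  {v : EuclideanSpace ℝ (Fin n)}

theorem IsNearBlock.norm_communityNegPart_sq_le (hT : IsNearBlock c a b β T) (τ : Bool)
    (hv : T v = lam • v) :
    lam * ‖communityNegPart c τ v‖ ^ 2 ≤
      ⟪communityNegPart c τ v, T (communityNegPart c τ v)⟫ +
        ⟪communityNegPart c τ v, T (communityNegPart c (!τ) v)⟫ := by
  have hpos : 0 ≤ ⟪communityNegPart c τ v, T (WithLp.toLp 2 fun i => (v i)⁺)⟫ :=
    hT.nonneg _ _ (communityNegPart_nonneg τ v) fun i => posPart_nonneg _
  have heigen : ⟪communityNegPart c τ v, T v⟫ = lam * -‖communityNegPart c τ v‖ ^ 2 := by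
    rw [hv, inner_smul_right, inner_communityNegPart_self]
  have hdecomp := congrArg (fun w => ⟪communityNegPart c τ v, T w⟫)
    (eq_posPart_sub_communityNegPart (c := c) τ v)
  simp only [map_sub, inner_sub_right] at hdecomp
  linarith

variable [NeZero n]

theorem communityCoeff_communityNegPart_sq_le (τ : Bool) (v : EuclideanSpace ℝ (Fin n))
    (hθ : #{i | c i = τ ∧ v i < 0} ≤ θ * (n / 2 : ℝ)) :
    communityCoeff c τ (communityNegPart c τ v) ^ 2 ≤ θ * ‖communityNegPart c τ v‖ ^ 2 := by
  set q := communityNegPart c τ v with hq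
  have hsupport : ∑ i with c i = τ, q i = ∑ i with c i = τ ∧ v i < 0, q i := by
    rw [← filter_filter]
    refine (sum_filter_of_ne fun i _ hi => ?_).symm
    by_contra! hv
    exact hi (by simp [hq, communityNegPart, hv])
  rw [communityCoeff_eq_sum, hsupport, mul_pow, inv_pow, sq_sqrt half_pos_of_neZero.le,
    inv_mul_le_iff₀ half_pos_of_neZero]
  calc (∑ i with c i = τ ∧ v i < 0, q i) ^ 2
      ≤ #{i | c i = τ ∧ v i < 0} * ∑ i with c i = τ ∧ v i < 0, q i ^ 2 :=
        sq_sum_le_card_mul_sum_sq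
    _ ≤ θ * (n / 2) * ‖q‖ ^ 2 := by
        rw [EuclideanSpace.real_norm_sq_eq]
        exact mul_le_mul hθ (sum_le_sum_of_subset_of_nonneg (filter_subset _ _)
          fun _ _ _ => sq_nonneg _) (by positivity) ((Nat.cast_nonneg _).trans hθ)
    _ = n / 2 * (θ * ‖q‖ ^ 2) := by ring

theorem IsNearBlock.mul_norm_communityNegPart_sq_le (hT : IsNearBlock c a b β T)
    (hc : IsBalanced c) (ha : 0 ≤ a) (hb : 0 ≤ b) (τ : Bool) (hv : T v = lam • v)
    (hθ : #{i | c i = τ ∧ v i < 0} ≤ θ * (n / 2 : ℝ)) :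
    (lam - a / 2 * θ - β) * ‖communityNegPart c τ v‖ ^ 2 ≤
      (b / 2 + β) * (‖communityNegPart c τ v‖ * ‖communityNegPart c (!τ) v‖) := by
  have hself := hT.norm_communityNegPart_sq_le τ hv
  have hcoeff := communityCoeff_communityNegPart_sq_le τ v hθ
  have hnot := communityCoeff_communityNegPart_not (c := c) τ v
  have hnot' := communityCoeff_communityNegPart_not (c := c) (!τ) v
  rw [Bool.not_not] at hnot'
  set q := communityNegPart c τ v
  set h := communityNegPart c (!τ) v
  have hqq := hT.inner_le q q
  have hqh := hT.inner_le q h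
  rw [blockForm, sum_bool_eq_add_not _ τ, hnot] at hqq hqh
  rw [hnot'] at hqh
  have hprod : communityCoeff c τ q * communityCoeff c (!τ) h ≤ ‖q‖ * ‖h‖ := by
    refine (le_abs_self _).trans ?_
    rw [abs_mul]
    gcongr <;> exact hc.abs_communityCoeff_le _ _
  linarith [mul_le_mul_of_nonneg_left hcoeff ha, mul_le_mul_of_nonneg_left hprod hb]

end NegativePart

section Signs

variable {n : ℕ} {c : Fin n → Bool}

theorem signsRecover_of_forall_card_le {v : Fin n → ℝ} {m : ℝ} {α : Bool → SignType}
    (hα : α true ≠ α false)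
    (h : ∀ τ, (#{i | c i = τ ∧ SignType.sign (v i) ≠ α τ} : ℝ) ≤ m / 2) :
    SignsRecover c v m := by
  refine ⟨α true, α false, hα, ?_⟩
  have hlabel : ∀ i, (if c i = true then α true else α false) = α (c i) := by
    intro i
    cases c i <;> simp
  simp only [hlabel, Set.ncard_eq_toFinset_card', Set.toFinset_ofPred]
  have hfiber : ∀ τ, #{i ∈ {i | SignType.sign (v i) ≠ α (c i)} | c i = τ} ≤
      #{i | c i = τ ∧ SignType.sign (v i) ≠ α τ} := by
    intro τ
    refine card_le_card fun i hi => ?_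
    simp only [mem_filter, mem_univ, true_and] at hi ⊢
    exact ⟨hi.2, hi.2 ▸ hi.1⟩
  rw [card_eq_sum_card_fiberwise fun i _ => mem_univ (c i), Fintype.sum_bool, Nat.cast_add]
  have htrue : (#{i ∈ {i | SignType.sign (v i) ≠ α (c i)} | c i = true} : ℝ) ≤ m / 2 :=
    (Nat.cast_le.2 (hfiber true)).trans (h true)
  have hfalse : (#{i ∈ {i | SignType.sign (v i) ≠ α (c i)} | c i = false} : ℝ) ≤ m / 2 :=
    (Nat.cast_le.2 (hfiber false)).trans (h false)
  linarith

theorem signsRecover_of_card_le {v : Fin n → ℝ} {m : ℝ} (τ : Bool) {α α' : SignType}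
    (hα : α ≠ α') (h : (#{i | c i = τ ∧ SignType.sign (v i) ≠ α} : ℝ) ≤ m / 2)
    (h' : (#{i | c i = (!τ) ∧ SignType.sign (v i) ≠ α'} : ℝ) ≤ m / 2) :
    SignsRecover c v m := by
  refine signsRecover_of_forall_card_le (α := fun σ => if σ = τ then α else α') ?_ ?_
  · cases τ <;> simp [hα, hα.symm]
  · intro σ
    obtain rfl | rfl : σ = τ ∨ σ = !τ := by cases σ <;> cases τ <;> simp
    · simpa using h
    · simpa using h'

theorem SignsRecover.of_neg {v : Fin n → ℝ} {m : ℝ} (h : SignsRecover c (-v) m) :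
    SignsRecover c v m := by
  obtain ⟨α, α', hα, hcard⟩ := h
  refine ⟨-α, -α', neg_injective.ne hα, ?_⟩
  simpa only [Pi.neg_apply, Left.sign_neg, ne_eq, neg_eq_iff_eq_neg,
    apply_ite (Neg.neg : SignType → SignType)] using hcard

theorem SignsRecover.of_smul {v : Fin n → ℝ} {m k : ℝ} (hk : 0 < k)
    (h : SignsRecover c (k • v) m) : SignsRecover c v m := by
  obtain ⟨α, α', hα, hcard⟩ := h
  refine ⟨α, α', hα, ?_⟩
  simpa only [Pi.smul_apply, smul_eq_mul, sign_mul, sign_pos hk, one_mul] using hcard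

theorem SignsRecover.mono {v : Fin n → ℝ} {m m' : ℝ} (hm : m ≤ m')
    (h : SignsRecover c v m) : SignsRecover c v m' := by
  obtain ⟨α, α', hα, hcard⟩ := h
  exact ⟨α, α', hα, hcard.trans hm⟩

theorem mul_nonpos_of_sign_ne {x y : ℝ} (h : SignType.sign x ≠ SignType.sign y) : x * y ≤ 0 := by
  by_contra! hpos
  rcases pos_and_pos_or_neg_and_neg_of_mul_pos hpos with ⟨hx, hy⟩ | ⟨hx, hy⟩
  · exact h (by rw [sign_pos hx, sign_pos hy])
  · exact h (by rw [sign_neg hx, sign_neg hy])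

theorem sign_ne_of_mul_neg {x y : ℝ} (h : x * y < 0) : SignType.sign x ≠ SignType.sign y := by
  rcases mul_neg_iff.1 h with ⟨hx, hy⟩ | ⟨hx, hy⟩ <;> simp [hx, hy, sign_pos]

theorem card_sign_ne_le_card_wrongSign (x : EuclideanSpace ℝ (Fin n)) (τ : Bool) :
    #{i | c i = τ ∧ SignType.sign (x i) ≠ SignType.sign (communityCoeff c τ x)} ≤
      #(wrongSign c x τ) := by
  unfold wrongSign
  gcongr with i
  exact mul_nonpos_of_sign_ne

theorem card_neg_le_card_wrongSign {x : EuclideanSpace ℝ (Fin n)} {τ : Bool}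
    (hx : 0 ≤ communityCoeff c τ x) : #{i | c i = τ ∧ x i < 0} ≤ #(wrongSign c x τ) := by
  unfold wrongSign
  gcongr with i
  exact fun hi => mul_nonpos_of_nonpos_of_nonneg hi.le hx

end Signs

section OrthogonalPairs

open scoped RealInnerProductSpace

variable {n : ℕ} {c : Fin n → Bool}

theorem mul_eq_zero_of_inner_eq_zero {u v : EuclideanSpace ℝ (Fin n)} (hu : ∀ i, 0 ≤ u i)
    (hv : ∀ i, 0 ≤ v i) (huv : ⟪u, v⟫ = 0) (i : Fin n) : v i * u i = 0 := by
  rw [PiLp.inner_apply] at huv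
  exact (sum_eq_zero_iff_of_nonneg fun i _ => mul_nonneg (hv i) (hu i)).1 huv i (mem_univ i)

theorem card_sign_ne_zero_le_card_wrongSign {u v : EuclideanSpace ℝ (Fin n)}
    (hu : ∀ i, 0 ≤ u i) (hv : ∀ i, 0 ≤ v i) (huv : ⟪u, v⟫ = 0) (τ : Bool) :
    #{i | c i = τ ∧ SignType.sign (v i) ≠ 0} ≤ #(wrongSign c u τ) := by
  unfold wrongSign
  gcongr with i
  intro hi
  have : u i = 0 :=
    (mul_eq_zero.1 (mul_eq_zero_of_inner_eq_zero hu hv huv i)).resolve_left (sign_ne_zero.1 hi)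
  rw [this, zero_mul]

variable [NeZero n] {δ : ℝ} {u v : EuclideanSpace ℝ (Fin n)}

theorem IsBalanced.sq_add_sq_communityCoeff_le (hc : IsBalanced c) (hu : ‖u‖ = 1) (τ : Bool) :
    communityCoeff c τ u ^ 2 + communityCoeff c (!τ) u ^ 2 ≤ 1 := by
  have := hc.norm_sq_eq u
  rw [hu, sum_bool_eq_add_not _ τ] at this
  linarith [sq_nonneg ‖communityResidual c u‖]

theorem IsBalanced.le_sq_add_sq_communityCoeff (hc : IsBalanced c) (hu : ‖u‖ = 1)
    (hδ : ‖communityResidual c u‖ ^ 2 ≤ δ) (τ : Bool) :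
    1 - δ ≤ communityCoeff c τ u ^ 2 + communityCoeff c (!τ) u ^ 2 := by
  have := hc.norm_sq_eq u
  rw [hu, sum_bool_eq_add_not _ τ] at this
  linarith

theorem IsBalanced.abs_mul_add_mul_communityCoeff_le (hc : IsBalanced c) (huv : ⟪u, v⟫ = 0)
    (hu : ‖communityResidual c u‖ ^ 2 ≤ δ) (hv : ‖communityResidual c v‖ ^ 2 ≤ δ) (τ : Bool) :
    |communityCoeff c τ u * communityCoeff c τ v +
      communityCoeff c (!τ) u * communityCoeff c (!τ) v| ≤ δ := by
  have hinner := hc.inner_eq u v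
  rw [huv, sum_bool_eq_add_not _ τ] at hinner
  rw [eq_neg_of_add_eq_zero_left hinner.symm, abs_neg]
  refine (abs_real_inner_le_norm _ _).trans ?_
  linarith [two_mul_le_add_sq ‖communityResidual c u‖ ‖communityResidual c v‖]

theorem mul_neg_of_abs_add_le {s t x y : ℝ} (hs : 0 ≤ s) (ht : 0 ≤ t) (hst : 9 / 10 ≤ s + t)
    (hx : 1 / 4 ≤ |x|) (hy : 1 / 4 ≤ |y|) (h : |s * x + t * y| ≤ 1 / 8100) : x * y < 0 := by
  by_contra! hxy
  have hmul : 0 ≤ s * x * (t * y) := by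
    rw [mul_mul_mul_comm]
    positivity
  rw [(abs_add_eq_add_abs_iff _ _).2 (mul_nonneg_iff.1 hmul), abs_mul, abs_mul, abs_of_nonneg hs,
    abs_of_nonneg ht] at h
  linarith [mul_le_mul_of_nonneg_left hx hs, mul_le_mul_of_nonneg_left hy ht]

theorem signsRecover_of_large_communityCoeff (hc : IsBalanced c) {ε : ℝ} (hε1 : ε ≤ 1)
    (hu : ‖u‖ = 1) (hu0 : ∀ i, 0 ≤ u i) (huv : ⟪u, v⟫ = 0)
    (hru : ‖communityResidual c u‖ ^ 2 ≤ ε / 8100) (hrv : ‖communityResidual c v‖ ^ 2 ≤ ε / 8100)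
    (hv : ∀ τ, 1 / 4 ≤ |communityCoeff c τ v|) : SignsRecover c v (ε * n) := by
  have hε0 : 0 ≤ ε := by linarith [sq_nonneg ‖communityResidual c u‖]
  have hcard : ∀ τ, (#{i | c i = τ ∧ SignType.sign (v i) ≠
      SignType.sign (communityCoeff c τ v)} : ℝ) ≤ ε * n / 2 := by
    intro τ
    have hsq : (1 / 4) ^ 2 ≤ communityCoeff c τ v ^ 2 := by
      rw [← sq_abs (communityCoeff c τ v)]
      exact pow_le_pow_left₀ (by norm_num) (hv τ) 2
    rw [mul_div_assoc]
    exact (Nat.cast_le.2 (card_sign_ne_le_card_wrongSign v τ)).trans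
      (card_wrongSign_le (by norm_num) hsq (by linarith))
  have hs := communityCoeff_nonneg (c := c) hu0 true
  have ht := communityCoeff_nonneg (c := c) hu0 (!true)
  have hst : 9 / 10 ≤ communityCoeff c true u + communityCoeff c (!true) u := by
    refine (pow_le_pow_iff_left₀ (by norm_num) (add_nonneg hs ht) two_ne_zero).1 ?_
    linarith [hc.le_sq_add_sq_communityCoeff hu hru true, mul_nonneg hs ht,
      add_sq (communityCoeff c true u) (communityCoeff c (!true) u)]
  exact signsRecover_of_forall_card_le (sign_ne_of_mul_neg <|
    mul_neg_of_abs_add_le hs ht hst (hv true) (hv false) <|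
      (hc.abs_mul_add_mul_communityCoeff_le huv hru hrv true).trans (by linarith)) hcard

theorem coeff_bounds_of_small {s t x y : ℝ} (hδ : δ ≤ 1 / 8100) (hs0 : 0 ≤ s) (ht0 : 0 ≤ t)
    (hst1 : s ^ 2 + t ^ 2 ≤ 1) (hst : 1 - δ ≤ s ^ 2 + t ^ 2) (hxy : 1 - δ ≤ x ^ 2 + y ^ 2)
    (hsum : |s * x + t * y| ≤ δ) (hx : |x| < 1 / 4) (hy : 0 ≤ y) :
    7 / 8 ≤ y ^ 2 ∧ t ≤ 3 / 10 ∧ 9 / 10 ≤ s := by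
  have hx2 : x ^ 2 ≤ (1 / 4) ^ 2 := sq_le_sq' (abs_lt.1 hx).1.le (abs_lt.1 hx).2.le
  have hy2 : 7 / 8 ≤ y ^ 2 := by linarith
  have hy9 : 9 / 10 ≤ y := (pow_le_pow_iff_left₀ (by norm_num) hy two_ne_zero).1 (by linarith)
  have hs1 : s ≤ 1 := (sq_le_one_iff₀ hs0).1 (by linarith [sq_nonneg t])
  have ht : t ≤ 3 / 10 := by
    have hsx : s * -(1 / 4) ≤ s * x := mul_le_mul_of_nonneg_left (abs_lt.1 hx).1.le hs0
    have hty : t * (9 / 10) ≤ t * y := mul_le_mul_of_nonneg_left hy9 ht0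
    linarith [(abs_le.1 hsum).2]
  have ht2 : t ^ 2 ≤ (3 / 10) ^ 2 := by gcongr
  exact ⟨hy2, ht, (pow_le_pow_iff_left₀ (by norm_num) hs0 two_ne_zero).1 (by linarith)⟩

end OrthogonalPairs

section SecondEigenvector

open scoped RealInnerProductSpace

variable {n : ℕ} {c : Fin n → Bool} {a b β ε lam lam₁ : ℝ}
  {T : EuclideanSpace ℝ (Fin n) →L[ℝ] EuclideanSpace ℝ (Fin n)}

theorem eq_zero_of_mutual_bounds {X Y : ℝ} (hε : 0 < ε) (hε1 : ε ≤ 1) (ha : 0 < a)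
    (hbβ : b ≤ 8 * β) (hβ : β ≤ ε / 200 * a) (hlam : (a - b) / 2 - β ≤ lam)
    (hX0 : 0 ≤ X) (hY0 : 0 ≤ Y)
    (hX : (lam - a / 2 * (1 - ε) - β) * X ^ 2 ≤ (b / 2 + β) * (X * Y))
    (hY : (lam - a / 2 * (1 / 2) - β) * Y ^ 2 ≤ (b / 2 + β) * (Y * X)) : X = 0 ∧ Y = 0 := by
  have hεa : 0 < ε * a := by positivity
  have hεa' : ε * a ≤ a := mul_le_of_le_one_left ha.le hε1
  have hXX : ε * a * (2 / 5 * X ^ 2) ≤ ε * a * (1 / 40 * (X * Y)) :=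
    calc ε * a * (2 / 5 * X ^ 2) = 2 / 5 * (ε * a) * X ^ 2 := by ring
      _ ≤ (lam - a / 2 * (1 - ε) - β) * X ^ 2 := by gcongr; linarith
      _ ≤ (b / 2 + β) * (X * Y) := hX
      _ ≤ 1 / 40 * (ε * a) * (X * Y) := by gcongr; linarith
      _ = ε * a * (1 / 40 * (X * Y)) := by ring
  have hYY : a * (1 / 5 * Y ^ 2) ≤ a * (1 / 40 * (X * Y)) :=
    calc a * (1 / 5 * Y ^ 2) = 1 / 5 * a * Y ^ 2 := by ring
      _ ≤ (lam - a / 2 * (1 / 2) - β) * Y ^ 2 := by gcongr; linarith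
      _ ≤ (b / 2 + β) * (Y * X) := hY
      _ ≤ 1 / 40 * a * (Y * X) := by gcongr; linarith
      _ = a * (1 / 40 * (X * Y)) := by ring
  have := le_of_mul_le_mul_left hXX hεa
  have := le_of_mul_le_mul_left hYY ha
  have := two_mul_le_add_sq X Y
  exact ⟨pow_eq_zero_iff two_ne_zero |>.1 (le_antisymm (by linarith [sq_nonneg Y]) (sq_nonneg X)),
    pow_eq_zero_iff two_ne_zero |>.1 (le_antisymm (by linarith [sq_nonneg X]) (sq_nonneg Y))⟩

theorem IsBalanced.card_neg_le_of_le_card_nonneg (hc : IsBalanced c) {v : Fin n → ℝ} {τ : Bool}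
    (h : ε * (n / 2) ≤ #{i | c i = τ ∧ 0 ≤ v i}) :
    #{i | c i = τ ∧ v i < 0} ≤ (1 - ε) * (n / 2 : ℝ) := by
  have hsum := card_filter_add_card_filter_not (s := ({i | c i = τ} : Finset (Fin n)))
    fun i => 0 ≤ v i
  simp only [filter_filter, not_le] at hsum
  have hcard := hc.card_community τ
  rw [← hsum, Nat.cast_add] at hcard
  linarith

/-- Orthogonal unit eigenvectors `u` and `v` of `T` with eigenvalues `κ₁ ≥ κ₂`, the first of which
has nonnegative entries. -/
structure IsLeadingPair (T : EuclideanSpace ℝ (Fin n) →L[ℝ] EuclideanSpace ℝ (Fin n))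
    (κ₁ κ₂ : ℝ) (u v : EuclideanSpace ℝ (Fin n)) : Prop where
  norm_left : ‖u‖ = 1
  norm_right : ‖v‖ = 1
  apply_left : T u = κ₁ • u
  apply_right : T v = κ₂ • v
  nonneg : ∀ i, 0 ≤ u i
  inner_eq_zero : ⟪u, v⟫ = 0
  le : κ₂ ≤ κ₁

theorem IsLeadingPair.neg {u v : EuclideanSpace ℝ (Fin n)} (h : IsLeadingPair T lam₁ lam u v) :
    IsLeadingPair T lam₁ lam u (-v) where
  norm_left := h.norm_left
  norm_right := by rw [norm_neg, h.norm_right]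
  apply_left := h.apply_left
  apply_right := by rw [map_neg, h.apply_right, smul_neg]
  nonneg := h.nonneg
  inner_eq_zero := by rw [inner_neg_right, h.inner_eq_zero, neg_zero]
  le := h.le

variable [NeZero n] {u v : EuclideanSpace ℝ (Fin n)}

theorem IsNearBlock.norm_communityResidual_sq_le (hT : IsNearBlock c a b β T)
    (hc : IsBalanced c) (hε1 : ε ≤ 1) (hba : b < a)
    (hβ : β ≤ ε / 200 * (a - b)) (hlam : (a - b) / 2 - β ≤ lam) (hu : ‖u‖ = 1)
    (hTu : T u = lam • u) : ‖communityResidual c u‖ ^ 2 ≤ ε / 8100 := by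
  have hab : 0 < a - b := sub_pos.2 hba
  have hε0 : 0 ≤ ε := by
    have := nonneg_of_mul_nonneg_left ((hT.radius_nonneg hu).trans hβ) hab
    linarith
  have hlam' : 99 / 200 * (a - b) ≤ lam := by
    have : ε / 200 * (a - b) ≤ 1 / 200 * (a - b) := by gcongr
    linarith
  have hmul : 99 / 200 * (a - b) * ‖communityResidual c u‖ ≤ ε / 200 * (a - b) :=
    calc 99 / 200 * (a - b) * ‖communityResidual c u‖ ≤ lam * ‖communityResidual c u‖ := by gcongr
      _ ≤ β := hT.norm_communityResidual_le hc hu hTu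
      _ ≤ ε / 200 * (a - b) := hβ
  have hle : ‖communityResidual c u‖ ≤ ε / 90 := by
    refine le_of_mul_le_mul_right ?_ hab
    linarith [mul_nonneg hε0 hab.le]
  calc ‖communityResidual c u‖ ^ 2 ≤ (ε / 90) ^ 2 := by gcongr
    _ = ε * ε / 8100 := by ring
    _ ≤ ε / 8100 := by gcongr; exact mul_le_of_le_one_left hε0 hε1

theorem IsNearBlock.cross_density_le (hT : IsNearBlock c a b β T) (hc : IsBalanced c)
    (ha : 0 ≤ a) (hb : 0 ≤ b) (hu : ‖u‖ = 1) (hTu : T u = lam₁ • u) {τ : Bool}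
    (ht0 : 0 ≤ communityCoeff c (!τ) u) (ht : communityCoeff c (!τ) u ≤ 3 / 10)
    (hs : 9 / 10 ≤ communityCoeff c τ u) : b ≤ 8 * β := by
  have hβ := hT.radius_nonneg hu
  have hst := hc.sq_add_sq_communityCoeff_le hu τ
  have hfu := hT.le_inner (communityVec c (!τ)) u
  rw [hc.orthonormal_communityVec.1, hu, hTu, inner_smul_right, blockForm,
    sum_bool_eq_add_not _ τ, hc.communityCoeff_communityVec, hc.communityCoeff_communityVec,
    if_neg (by simp), if_pos rfl, Bool.not_not, ← communityCoeff] at hfu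
  have huu := hT.inner_le u u
  rw [hTu, inner_smul_right, real_inner_self_eq_norm_sq, hu, blockForm,
    sum_bool_eq_add_not _ τ, Bool.not_not] at huu
  generalize communityCoeff c τ u = s at *
  generalize communityCoeff c (!τ) u = t at *
  have hlam : lam₁ ≤ a / 2 + b / 2 + β := by
    linarith [mul_le_mul_of_nonneg_left hst ha,
      mul_le_mul_of_nonneg_left ((two_mul_le_add_sq s t).trans hst) hb]
  linarith [mul_le_mul_of_nonneg_right hlam ht0, mul_le_mul_of_nonneg_left ht hβ,
    mul_le_mul_of_nonneg_left hs hb, mul_le_mul_of_nonneg_left ht hb]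

theorem IsNearBlock.nonneg_of_card_neg_le (hT : IsNearBlock c a b β T) (hc : IsBalanced c)
    (hε : 0 < ε) (hε1 : ε ≤ 1) (hb : 0 ≤ b) (hba : b < a) (hβ : β ≤ ε / 200 * (a - b))
    (hbβ : b ≤ 8 * β) (hlam : (a - b) / 2 - β ≤ lam) (hTv : T v = lam • v) {τ : Bool}
    (hτ : #{i | c i = τ ∧ v i < 0} ≤ (1 - ε) * (n / 2 : ℝ))
    (hτ' : #{i | c i = (!τ) ∧ v i < 0} ≤ 1 / 2 * (n / 2 : ℝ)) (i : Fin n) : 0 ≤ v i := by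
  have ha : 0 < a := hb.trans_lt hba
  have hβa : β ≤ ε / 200 * a := hβ.trans (by gcongr; linarith)
  have hX := hT.mul_norm_communityNegPart_sq_le hc ha.le hb τ hTv hτ
  have hY := hT.mul_norm_communityNegPart_sq_le hc ha.le hb (!τ) hTv hτ'
  rw [Bool.not_not] at hY
  obtain ⟨hX0, hY0⟩ := eq_zero_of_mutual_bounds hε hε1 ha hbβ hβa hlam (norm_nonneg _)
    (norm_nonneg _) hX hY
  refine nonneg_of_communityNegPart_eq_zero (c := c) (fun σ => ?_) i
  obtain rfl | rfl : σ = τ ∨ σ = !τ := by cases σ <;> cases τ <;> simp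
  exacts [norm_eq_zero.1 hX0, norm_eq_zero.1 hY0]

/-- If `v` is nearly orthogonal to the indicator of the community `τ`, then so is `u` to that of
the other community, so that there are few edges across. Either `v` is negative on most of `τ`,
or its negative part has to vanish; then `v` vanishes wherever `u` does not, which is on most of
`τ`. -/
theorem IsNearBlock.signsRecover_of_small_communityCoeff (hT : IsNearBlock c a b β T)
    (hc : IsBalanced c) (hε : 0 < ε) (hε1 : ε ≤ 1) (hb : 0 ≤ b) (hba : b < a)
    (hβ : β ≤ ε / 200 * (a - b)) (h : IsLeadingPair T lam₁ lam u v)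
    (hlam : (a - b) / 2 - β ≤ lam) {τ : Bool} (hτ : |communityCoeff c τ v| < 1 / 4)
    (hτ' : 0 ≤ communityCoeff c (!τ) v) : SignsRecover c v (ε * n) := by
  have hru := hT.norm_communityResidual_sq_le hc hε1 hba hβ (hlam.trans h.le) h.norm_left
    h.apply_left
  have hrv := hT.norm_communityResidual_sq_le hc hε1 hba hβ hlam h.norm_right h.apply_right
  have ht0 := communityCoeff_nonneg (c := c) h.nonneg (!τ)
  obtain ⟨hy, ht, hs⟩ := coeff_bounds_of_small (by linarith)
    (communityCoeff_nonneg (c := c) h.nonneg τ) ht0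
    (hc.sq_add_sq_communityCoeff_le h.norm_left τ)
    (hc.le_sq_add_sq_communityCoeff h.norm_left hru τ)
    (hc.le_sq_add_sq_communityCoeff h.norm_right hrv τ)
    (hc.abs_mul_add_mul_communityCoeff_le h.inner_eq_zero hru hrv τ) hτ hτ'
  have hbβ := hT.cross_density_le hc (hb.trans hba.le) hb h.norm_left h.apply_left ht0 ht hs
  have hsign : SignType.sign (communityCoeff c (!τ) v) = 1 :=
    sign_pos (hτ'.lt_of_ne fun h0 => by rw [← h0] at hy; norm_num at hy)
  have hpos : (#{i | c i = (!τ) ∧ SignType.sign (v i) ≠ 1} : ℝ) ≤ ε * n / 2 := by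
    rw [← hsign, mul_div_assoc]
    exact (Nat.cast_le.2 (card_sign_ne_le_card_wrongSign v _)).trans
      (card_wrongSign_le (by norm_num) hy (by linarith))
  have hneg : #{i | c i = (!τ) ∧ v i < 0} ≤ 1 / 2 * (n / 2 : ℝ) :=
    (Nat.cast_le.2 (card_neg_le_card_wrongSign hτ')).trans
      (card_wrongSign_le (by norm_num) hy (by linarith))
  rcases le_total (#{i | c i = τ ∧ 0 ≤ v i} : ℝ) (ε * (n / 2)) with hfew | hmany
  · refine signsRecover_of_card_le τ (α := -1) (by decide) ?_ hpos
    rw [mul_div_assoc]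
    refine le_trans ?_ hfew
    gcongr with i
    exact fun hi => not_lt.1 fun hlt => hi (sign_neg hlt)
  · have hv0 := hT.nonneg_of_card_neg_le hc hε hε1 hb hba hβ hbβ hlam h.apply_right
      (hc.card_neg_le_of_le_card_nonneg hmany) hneg
    refine signsRecover_of_card_le τ (α := 0) (by decide) ?_ hpos
    have hs2 : (9 / 10) ^ 2 ≤ communityCoeff c τ u ^ 2 := by gcongr
    rw [mul_div_assoc]
    exact (Nat.cast_le.2 (card_sign_ne_zero_le_card_wrongSign h.nonneg hv0 h.inner_eq_zero τ)).trans
      (card_wrongSign_le (by norm_num) hs2 (by linarith))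

theorem IsNearBlock.signsRecover (hT : IsNearBlock c a b β T) (hc : IsBalanced c) (hε : 0 < ε)
    (hε1 : ε ≤ 1) (hb : 0 ≤ b) (hba : b < a) (hβ : β ≤ ε / 200 * (a - b))
    (h : IsLeadingPair T lam₁ lam u v) (hlam : (a - b) / 2 - β ≤ lam) :
    SignsRecover c v (ε * n) := by
  by_cases hlarge : ∀ τ, 1 / 4 ≤ |communityCoeff c τ v|
  · exact signsRecover_of_large_communityCoeff hc hε1 h.norm_left h.nonneg h.inner_eq_zero
      (hT.norm_communityResidual_sq_le hc hε1 hba hβ (hlam.trans h.le) h.norm_left h.apply_left)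
      (hT.norm_communityResidual_sq_le hc hε1 hba hβ hlam h.norm_right h.apply_right) hlarge
  obtain ⟨τ, hτ⟩ := not_forall.1 hlarge
  rw [not_le] at hτ
  rcases le_total 0 (communityCoeff c (!τ) v) with hτ' | hτ'
  · exact hT.signsRecover_of_small_communityCoeff hc hε hε1 hb hba hβ h hlam hτ hτ'
  · refine SignsRecover.of_neg ?_
    exact hT.signsRecover_of_small_communityCoeff (v := -v) hc hε hε1 hb hba hβ h.neg hlam
      (by rwa [communityCoeff_neg, abs_neg]) (by rwa [communityCoeff_neg, neg_nonneg])

end SecondEigenvector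

section Eigenbasis

open scoped RealInnerProductSpace

variable {ι E : Type*} [Fintype ι] [NormedAddCommGroup E] [InnerProductSpace ℝ E]
  (e : OrthonormalBasis ι ℝ E) (T : E →L[ℝ] E) {κ : ι → ℝ} {lam : ℝ}

theorem inner_apply_eq_sum (he : ∀ i, T (e i) = κ i • e i) (x : E) :
    ⟪x, T x⟫ = ∑ i, κ i * ⟪e i, x⟫ ^ 2 := by
  have hTx : T x = ∑ i, ⟪e i, x⟫ • κ i • e i := by
    conv_lhs => rw [← e.sum_repr' x]
    simp only [map_sum, map_smul, he]
  rw [hTx, inner_sum]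
  refine sum_congr rfl fun i _ => ?_
  rw [inner_smul_right, inner_smul_right, real_inner_comm]
  ring

theorem inner_apply_le_of_inner_eq_zero (he : ∀ i, T (e i) = κ i • e i) {k : ι}
    (hκ : ∀ i, i ≠ k → κ i ≤ lam) {x : E} (hx : ⟪e k, x⟫ = 0) : ⟪x, T x⟫ ≤ lam * ‖x‖ ^ 2 := by
  rw [inner_apply_eq_sum e T he, ← e.sum_sq_inner_right, mul_sum]
  refine sum_le_sum fun i _ => ?_
  by_cases hi : i = k
  · simp [hi, hx]
  · exact mul_le_mul_of_nonneg_right (hκ i hi) (sq_nonneg _)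

theorem apply_eq_smul_of_le_inner_apply (he : ∀ i, T (e i) = κ i • e i) (hκ : ∀ i, κ i ≤ lam)
    {x : E} (hx : lam * ‖x‖ ^ 2 ≤ ⟪x, T x⟫) : T x = lam • x := by
  have hnonneg : ∀ i ∈ univ, 0 ≤ (lam - κ i) * ⟪e i, x⟫ ^ 2 := fun i _ =>
    mul_nonneg (sub_nonneg.2 (hκ i)) (sq_nonneg _)
  have hsum : ∑ i, (lam - κ i) * ⟪e i, x⟫ ^ 2 = 0 := by
    refine le_antisymm ?_ (sum_nonneg hnonneg)
    rw [inner_apply_eq_sum e T he, ← e.sum_sq_inner_right, mul_sum] at hx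
    simpa only [sub_mul, sum_sub_distrib, sub_nonpos] using hx
  have hcoord : ∀ i, ⟪e i, x⟫ * κ i = lam * ⟪e i, x⟫ := by
    intro i
    rcases mul_eq_zero.1 ((sum_eq_zero_iff_of_nonneg hnonneg).1 hsum i (mem_univ i)) with h | h
    · rw [← sub_eq_zero.1 h, mul_comm]
    · rw [pow_eq_zero_iff two_ne_zero |>.1 h, zero_mul, mul_zero]
  conv_lhs => rw [← e.sum_repr' x]
  conv_rhs => rw [← e.sum_repr' x]
  simp only [map_sum, map_smul, he, smul_sum, smul_smul, hcoord]

end Eigenbasis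

section NonnegativeMatrices

open scoped RealInnerProductSpace

variable {ι : Type*} [Fintype ι]

/-- The entrywise absolute value of a vector. -/
noncomputable def entrywiseAbs (x : EuclideanSpace ℝ ι) : EuclideanSpace ℝ ι :=
  WithLp.toLp 2 fun i => |x i|

theorem norm_entrywiseAbs (x : EuclideanSpace ℝ ι) : ‖entrywiseAbs x‖ = ‖x‖ := by
  simp [EuclideanSpace.norm_eq, entrywiseAbs]

variable [DecidableEq ι] {A : Matrix ι ι ℝ}

theorem inner_toEuclideanCLM_le_entrywiseAbs (hA : ∀ i j, 0 ≤ A i j) (x : EuclideanSpace ℝ ι) :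
    ⟪x, Matrix.toEuclideanCLM (𝕜 := ℝ) A x⟫ ≤
      ⟪entrywiseAbs x, Matrix.toEuclideanCLM (𝕜 := ℝ) A (entrywiseAbs x)⟫ := by
  simp only [Matrix.inner_toEuclideanCLM, dotProduct, Matrix.mulVec, mul_sum]
  refine sum_le_sum fun i _ => sum_le_sum fun j _ => ?_
  rw [mul_left_comm, mul_left_comm (entrywiseAbs x i)]
  refine mul_le_mul_of_nonneg_left ?_ (hA i j)
  exact (le_abs_self _).trans_eq (abs_mul _ _)

variable {ι' : Type*} [Fintype ι'] {κ : ι' → ℝ}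
  (e : OrthonormalBasis ι' ℝ (EuclideanSpace ℝ ι))

theorem toEuclideanCLM_entrywiseAbs_eq_smul (hA : ∀ i j, 0 ≤ A i j)
    (he : ∀ i, Matrix.toEuclideanCLM (𝕜 := ℝ) A (e i) = κ i • e i) {k : ι'}
    (hκ : ∀ i, κ i ≤ κ k) :
    Matrix.toEuclideanCLM (𝕜 := ℝ) A (entrywiseAbs (e k)) = κ k • entrywiseAbs (e k) := by
  refine apply_eq_smul_of_le_inner_apply e _ he hκ ?_
  calc κ k * ‖entrywiseAbs (e k)‖ ^ 2
      = ⟪e k, Matrix.toEuclideanCLM (𝕜 := ℝ) A (e k)⟫ := by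
        rw [he, inner_smul_right, real_inner_self_eq_norm_sq, norm_entrywiseAbs]
    _ ≤ _ := inner_toEuclideanCLM_le_entrywiseAbs hA (e k)

theorem inner_eq_zero_of_eigenvalue_ne (hA : A.IsHermitian) {κ₁ κ₂ : ℝ} (hκ : κ₁ ≠ κ₂)
    {u v : EuclideanSpace ℝ ι} (hu : Matrix.toEuclideanCLM (𝕜 := ℝ) A u = κ₁ • u)
    (hv : Matrix.toEuclideanCLM (𝕜 := ℝ) A v = κ₂ • v) : ⟪u, v⟫ = 0 :=
  (Matrix.isSymmetric_toEuclideanLin_iff.2 hA).orthogonalFamily_eigenspaces hκ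
    ⟨u, Module.End.mem_eigenspace_iff.2 hu⟩ ⟨v, Module.End.mem_eigenspace_iff.2 hv⟩

theorem exists_nonneg_eigenvector_inner_eq_zero (hA : ∀ i j, 0 ≤ A i j) (hs : A.IsHermitian)
    (he : ∀ i, Matrix.toEuclideanCLM (𝕜 := ℝ) A (e i) = κ i • e i) {k : ι'}
    (hκ : ∀ i, κ i ≤ κ k) {lam : ℝ} (hlam : lam ≠ κ k) {v : EuclideanSpace ℝ ι}
    (hv : Matrix.toEuclideanCLM (𝕜 := ℝ) A v = lam • v) :
    ∃ u : EuclideanSpace ℝ ι, u ≠ 0 ∧ (∀ i, 0 ≤ u i) ∧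
      Matrix.toEuclideanCLM (𝕜 := ℝ) A u = κ k • u ∧ ⟪u, v⟫ = 0 := by
  have habs := toEuclideanCLM_entrywiseAbs_eq_smul e hA he hκ
  refine ⟨entrywiseAbs (e k), ?_, fun i => abs_nonneg _, habs,
    inner_eq_zero_of_eigenvalue_ne hs hlam.symm habs hv⟩
  rw [← norm_ne_zero_iff, norm_entrywiseAbs, e.norm_eq_one]
  exact one_ne_zero

end NonnegativeMatrices

section SecondEigenvalue

open scoped RealInnerProductSpace

variable {n : ℕ}

theorem exists_sum_smul_inner_eq_zero {E : Type*} [NormedAddCommGroup E] [InnerProductSpace ℝ E]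
    (f : Bool → E) (x : E) : ∃ w : Bool → ℝ, 0 < ∑ σ, w σ ^ 2 ∧ ⟪x, ∑ σ, w σ • f σ⟫ = 0 := by
  by_cases h : ∀ σ, ⟪x, f σ⟫ = 0
  · exact ⟨1, by simp, by simp [inner_add_right, h]⟩
  · obtain ⟨τ, hτ⟩ := not_forall.1 h
    refine ⟨fun σ => if σ = τ then -⟪x, f (!τ)⟫ else ⟪x, f τ⟫, ?_, ?_⟩
    · simp only [sum_bool_eq_add_not _ τ, Bool.not_eq_self, if_true, if_false]
      positivity
    · simp only [sum_bool_eq_add_not _ τ, Bool.not_eq_self, if_true, if_false, inner_add_right,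
        inner_smul_right]
      ring

theorem isLeadingPair_normalize {T : EuclideanSpace ℝ (Fin n) →L[ℝ] EuclideanSpace ℝ (Fin n)}
    {κ₁ κ₂ : ℝ} {u v : EuclideanSpace ℝ (Fin n)} (hu : u ≠ 0) (hv : v ≠ 0)
    (hTu : T u = κ₁ • u) (hTv : T v = κ₂ • v) (hu0 : ∀ i, 0 ≤ u i) (huv : ⟪u, v⟫ = 0)
    (hκ : κ₂ ≤ κ₁) : IsLeadingPair T κ₁ κ₂ (‖u‖⁻¹ • u) (‖v‖⁻¹ • v) where
  norm_left := norm_smul_inv_norm hu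
  norm_right := norm_smul_inv_norm hv
  apply_left := by rw [map_smul, hTu, smul_comm]
  apply_right := by rw [map_smul, hTv, smul_comm]
  nonneg i := mul_nonneg (inv_nonneg.2 (norm_nonneg u)) (hu0 i)
  inner_eq_zero := by rw [inner_smul_left, inner_smul_right, huv, mul_zero, mul_zero]
  le := hκ

variable [NeZero n] {c : Fin n → Bool} {a b β : ℝ}

theorem IsBalanced.norm_sq_sum (hc : IsBalanced c) (w : Bool → ℝ) :
    ‖∑ σ, w σ • communityVec c σ‖ ^ 2 = ∑ σ, w σ ^ 2 := by
  rw [← real_inner_self_eq_norm_sq, hc.orthonormal_communityVec.inner_sum]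
  simp [sq]

theorem IsBalanced.le_blockForm_sum (hc : IsBalanced c) (hb : 0 ≤ b) (w : Bool → ℝ) :
    (a - b) / 2 * ∑ σ, w σ ^ 2 ≤
      blockForm c a b (∑ σ, w σ • communityVec c σ) (∑ σ, w σ • communityVec c σ) := by
  simp only [blockForm, hc.communityCoeff_sum]
  simp only [Fintype.sum_bool, Bool.not_true, Bool.not_false]
  linarith [mul_nonneg hb (sq_nonneg (w true + w false))]

theorem IsNearBlock.le_second_eigenvalue {ι : Type*} [Fintype ι] {lam : ℝ}
    {T : EuclideanSpace ℝ (Fin n) →L[ℝ] EuclideanSpace ℝ (Fin n)} (hT : IsNearBlock c a b β T)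
    (hc : IsBalanced c) (hb : 0 ≤ b) (e : OrthonormalBasis ι ℝ (EuclideanSpace ℝ (Fin n)))
    {κ : ι → ℝ} (he : ∀ i, T (e i) = κ i • e i) {k : ι} (hκ : ∀ i, i ≠ k → κ i ≤ lam) :
    (a - b) / 2 - β ≤ lam := by
  obtain ⟨w, hw, horth⟩ := exists_sum_smul_inner_eq_zero (communityVec c) (e k)
  set x := ∑ σ, w σ • communityVec c σ with hx
  have hnorm : ‖x‖ ^ 2 = ∑ σ, w σ ^ 2 := hc.norm_sq_sum w
  have hblock := hc.le_blockForm_sum (a := a) hb w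
  rw [← hx, ← hnorm] at hblock
  have hlower := hT.le_inner x x
  have hupper := inner_apply_le_of_inner_eq_zero e T he hκ horth
  rw [← hnorm] at hw
  refine le_of_mul_le_mul_right ?_ hw
  linarith

theorem IsSecondEigenvector.signsRecover {ε : ℝ} (hc : IsBalanced c) (hε : 0 < ε) (hε1 : ε ≤ 1)
    (hb : 0 ≤ b) (hba : b < a) (hβ : β ≤ ε / 200 * (a - b)) {A : Matrix (Fin n) (Fin n) ℝ}
    (hA : ∀ i j, 0 ≤ A i j)
    (hAβ : ‖Matrix.toEuclideanCLM (𝕜 := ℝ) (A - blockMatrix c (a / n) (b / n))‖ ≤ β)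
    {v : Fin n → ℝ} (hv : IsSecondEigenvector A v) : SignsRecover c v (ε * n) := by
  obtain ⟨hs, k₁, k₂, hk₁, hk₂, hv0, hAv, hdegenerate⟩ := hv
  have hT := isNearBlock_toEuclideanCLM hA hAβ
  have hself := Matrix.isSymmetric_toEuclideanLin_iff.2 hs
  have he := hself.apply_eigenvectorBasis finrank_euclideanSpace
  set e := hself.eigenvectorBasis finrank_euclideanSpace
  have hle₁ : ∀ i, hs.eigenvalues₀ i ≤ hs.eigenvalues₀ k₁ := fun i =>
    hs.eigenvalues₀_antitone (Fin.le_def.2 (by omega))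
  have hle₂ : ∀ i, i ≠ k₁ → hs.eigenvalues₀ i ≤ hs.eigenvalues₀ k₂ := fun i hi =>
    hs.eigenvalues₀_antitone (Fin.le_def.2 (by have := Fin.val_ne_of_ne hi; omega))
  have hlam := hT.le_second_eigenvalue hc hb e he hle₂
  have hTv : Matrix.toEuclideanCLM (𝕜 := ℝ) A (WithLp.toLp 2 v) =
      hs.eigenvalues₀ k₂ • WithLp.toLp 2 v := by
    rw [Matrix.toEuclideanCLM_toLp, hAv, WithLp.toLp_smul]
  have hv0' : WithLp.toLp 2 v ≠ 0 := (WithLp.toLp_eq_zero 2).not.2 hv0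
  obtain ⟨u, hu0, hupos, hTu, huv⟩ : ∃ u : EuclideanSpace ℝ (Fin n), u ≠ 0 ∧ (∀ i, 0 ≤ u i) ∧
      Matrix.toEuclideanCLM (𝕜 := ℝ) A u = hs.eigenvalues₀ k₁ • u ∧ ⟪u, WithLp.toLp 2 v⟫ = 0 := by
    by_cases heq : hs.eigenvalues₀ k₁ = hs.eigenvalues₀ k₂
    · obtain ⟨u, hu0, hupos, hAu, huv⟩ := hdegenerate heq
      refine ⟨WithLp.toLp 2 u, (WithLp.toLp_eq_zero 2).not.2 hu0, hupos, ?_, ?_⟩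
      · rw [Matrix.toEuclideanCLM_toLp, hAu, WithLp.toLp_smul]
      · rw [EuclideanSpace.inner_toLp_toLp, star_trivial, dotProduct_comm, huv]
    · exact exists_nonneg_eigenvector_inner_eq_zero e hA hs he hle₁ (Ne.symm heq) hTv
  exact SignsRecover.of_smul (inv_pos.2 (norm_pos_iff.2 hv0')) <|
    hT.signsRecover hc hε hε1 hb hba hβ
      (isLeadingPair_normalize hu0 hv0' hTu hTv hupos huv (hle₁ k₂)) hlam

end SecondEigenvalue

section TypicalSamples

variable {n : ℕ} {a b ρ : ℝ} {L : ℕ}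

/-- The properties of the adjacency matrix `A` of a sample with edge probabilities `P` on which the
norm bound for its degree regularizations depends. -/
structure IsTypicalSample (A P : Matrix (Fin n) (Fin n) ℝ) (a ρ : ℝ) (L : ℕ) : Prop where
  hasLightBound : HasLightBound (A - P) a ρ
  hasDiscrepancy : HasDiscrepancy A a ρ L
  hasDegreeTail : HasDegreeTail A a ρ

theorem IsTypicalSample.norm_toEuclideanCLM_sub_le {A P A' M : Matrix (Fin n) (Fin n) ℝ}
    (hAP : IsTypicalSample A P a ρ L) (h : IsDegreeRegularization A (2 * a) A')
    (hA : ∀ i j, 0 ≤ A i j) (hsymm : A.IsSymm) (hPM : ∀ i j, i ≠ j → P i j = M i j)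
    (hdiag : ∀ i, |P i i - M i i| ≤ 1) (hMsymm : M.IsSymm) (hM : ∀ i j, 0 ≤ M i j)
    (hMa : ∀ i j, M i j ≤ a / n) (hn : 0 < n) (ha : 1 ≤ a) (hρ : 0 ≤ ρ) (hL : 2 ^ L ≤ √a)
    (hL' : √a ≤ 2 ^ (L + 1)) :
    ‖Matrix.toEuclideanCLM (𝕜 := ℝ) (A' - M)‖ ≤ deviationConstant ρ * √a / 8 := by
  refine norm_toEuclideanCLM_le_of_int hn (h.symm.sub hMsymm) fun z hz => ?_
  rw [mul_right_comm]
  exact h.abs_quadraticForm_sub_le hA hsymm hAP.hasLightBound hAP.hasDiscrepancy hAP.hasDegreeTail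
    hPM hdiag hM hMa hn ha hρ hL hL' hz

variable {Ω : Type*} [MeasurableSpace Ω] {μ : Measure Ω} [IsProbabilityMeasure μ]
  {G : Ω → SimpleGraph (Fin n)}

theorem HasIndependentEdges.measureReal_not_isTypicalSample_le (hG : HasIndependentEdges μ G)
    (hP : ∀ i j, edgeProbability μ G i j ≤ a / n) (hn : 0 < n) (ha : 0 < a) (hρ : 0 ≤ ρ) (L : ℕ) :
    μ.real {ω | ¬IsTypicalSample (adjacency (G ω)) (edgeProbability μ G) a ρ L} ≤
      6 * exp (-ρ) := by
  have hsubset : {ω | ¬IsTypicalSample (adjacency (G ω)) (edgeProbability μ G) a ρ L} ⊆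
      {ω | ¬HasLightBound (adjacency (G ω) - edgeProbability μ G) a ρ} ∪
        {ω | ¬HasDiscrepancy (adjacency (G ω)) a ρ L} ∪
        {ω | ¬HasDegreeTail (adjacency (G ω)) a ρ} := by
    intro ω hω
    by_contra hgood
    simp only [Set.mem_union, Set.mem_ofPred_eq, not_or, not_not] at hgood
    exact hω ⟨hgood.1.1, hgood.1.2, hgood.2⟩
  have hunion := (measureReal_mono (μ := μ) hsubset).trans <|
    (measureReal_union_le _ _).trans (add_le_add_left (measureReal_union_le _ _) _)
  linarith [hG.measureReal_not_hasLightBound_le hP hn ha hρ,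
    hG.measureReal_not_hasDiscrepancy_le hP ha.le hρ L,
    hG.measureReal_not_hasDegreeTail_le hP ha.le hn ρ]

end TypicalSamples

section PlantedPartition

variable {Ω : Type*} [MeasurableSpace Ω] {μ : Measure Ω} {n : ℕ} {c : Fin n → Bool}
  {G : Ω → SimpleGraph (Fin n)}

theorem IsPlantedPartitionGraph.hasIndependentEdges {p q : ℝ}
    (hG : IsPlantedPartitionGraph μ c p q G) : HasIndependentEdges μ G :=
  ⟨hG.measurableSet_adj, hG.indep⟩

theorem IsPlantedPartitionGraph.edgeProbability_eq {p q : ℝ}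
    (hG : IsPlantedPartitionGraph μ c p q G) (hp : 0 ≤ p) (hq : 0 ≤ q) {i j : Fin n}
    (hij : i ≠ j) : edgeProbability μ G i j = blockMatrix c p q i j := by
  rw [edgeProbability, measureReal_def, hG.prob_adj i j hij]
  exact ENNReal.toReal_ofReal (blockMatrix_nonneg hp hq i j)

theorem IsPlantedPartitionGraph.edgeProbability_le {p q : ℝ}
    (hG : IsPlantedPartitionGraph μ c p q G) (hq : 0 ≤ q) (hqp : q ≤ p) (i j : Fin n) :
    edgeProbability μ G i j ≤ p := by
  rcases eq_or_ne i j with rfl | hij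
  · exact (edgeProbability_self i).trans_le (hq.trans hqp)
  · exact (hG.edgeProbability_eq (hq.trans hqp) hq hij).trans_le (blockMatrix_le hqp i j)

variable {a b ε ρ : ℝ} {L : ℕ} [NeZero n]

theorem IsPlantedPartitionGraph.norm_toEuclideanCLM_sub_blockMatrix_le
    (hG : IsPlantedPartitionGraph μ c (a / n) (b / n) G) (hb : 0 ≤ b) (hba : b ≤ a) (ha : 1 ≤ a)
    (han : a ≤ n) (hρ : 0 ≤ ρ) (hL : 2 ^ L ≤ √a) (hL' : √a ≤ 2 ^ (L + 1)) {ω : Ω}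
    (hω : IsTypicalSample (adjacency (G ω)) (edgeProbability μ G) a ρ L)
    {A' : Matrix (Fin n) (Fin n) ℝ} (hA' : IsDegreeRegularization (adjacency (G ω)) (2 * a) A') :
    ‖Matrix.toEuclideanCLM (𝕜 := ℝ) (A' - blockMatrix c (a / n) (b / n))‖ ≤
      deviationConstant ρ * √a / 8 := by
  have hp : 0 ≤ a / n := by positivity
  have hq : 0 ≤ b / n := by positivity
  refine hω.norm_toEuclideanCLM_sub_le hA' (fun i j => (adjacency_mem_Icc _ i j).1)
    (isSymm_adjacency _) (fun i j hij => hG.edgeProbability_eq hp hq hij) (fun i => ?_)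
    (isSymm_blockMatrix _ _) (blockMatrix_nonneg hp hq) (blockMatrix_le (by gcongr))
    (NeZero.pos n) ha hρ hL hL'
  rw [edgeProbability_self, zero_sub, abs_neg, blockMatrix, if_pos rfl, abs_of_nonneg hp]
  exact div_le_one_of_le₀ han n.cast_nonneg

theorem gap_bounds {D : ℝ} (hD : 0 ≤ D) (hε : 0 < ε) (hb : 0 ≤ b) (hba : b < a)
    (hgap : ((25 * D / ε) ^ 2 + 1) * (a + b) < (a - b) ^ 2) :
    1 ≤ a ∧ D * √a / 8 ≤ ε / 200 * (a - b) := by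
  have ha : 0 < a := hb.trans_lt hba
  have hgap' : (25 * D / ε) ^ 2 * a + a ≤ (a - b) ^ 2 := by
    have : 0 ≤ ((25 * D / ε) ^ 2 + 1) * b := by positivity
    linarith
  have hsq : (a - b) ^ 2 ≤ a * a := by
    rw [← sq]
    exact pow_le_pow_left₀ (by linarith) (by linarith) 2
  have hmul : 25 * D / ε * √a ≤ a - b := by
    refine (pow_le_pow_iff_left₀ (by positivity) (by linarith) two_ne_zero).1 ?_
    rw [mul_pow, sq_sqrt ha.le]
    linarith
  refine ⟨le_of_mul_le_mul_right ?_ ha, ?_⟩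
  · have : 0 ≤ (25 * D / ε) ^ 2 * a := by positivity
    linarith
  · calc D * √a / 8 = ε / 200 * (25 * D / ε * √a) := by field
      _ ≤ ε / 200 * (a - b) := by gcongr

theorem six_mul_exp_neg_add_two_le (r : ℝ) : 6 * exp (-(r + 2)) ≤ exp (-r) := by
  have hsix : 6 ≤ exp 2 := by
    calc (6 : ℝ) ≤ 2.7 ^ 2 := by norm_num
      _ ≤ exp 1 ^ 2 := by gcongr; exact (by norm_num : (2.7 : ℝ) ≤ _).trans exp_one_gt_d9.le
      _ = exp 2 := by rw [← exp_nat_mul]; norm_num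
  calc 6 * exp (-(r + 2)) ≤ exp 2 * exp (-(r + 2)) := by gcongr
    _ = exp (-r) := by rw [← exp_add]; ring_nf

theorem one_sub_measureReal_compl_le [IsProbabilityMeasure μ] (s : Set Ω) :
    1 - μ.real sᶜ ≤ μ.real s := by
  rw [sub_le_iff_le_add, ← probReal_univ (μ := μ), ← Set.union_compl_self s]
  exact measureReal_union_le s sᶜ

end PlantedPartition

theorem mainTheorem3 :
    ∀ (ε r : ℝ), 0 < ε → 1 ≤ r →
      ∃ C : ℝ, 0 < C ∧
        ∀ (n : ℕ) (a b : ℝ) (c : Fin n → Bool), IsBalanced c →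
          0 ≤ b → b < a → a ≤ n → (a - b) ^ 2 > C * (a + b) →
          ∀ (Ω : Type*) [MeasurableSpace Ω] (μ : Measure Ω) [IsProbabilityMeasure μ]
            (G : Ω → SimpleGraph (Fin n)),
            IsPlantedPartitionGraph μ c (a / n) (b / n) G →
            μ {ω | ∀ A' : Matrix (Fin n) (Fin n) ℝ,
                IsDegreeRegularization (adjacency (G ω)) (2 * a) A' →
                ∀ v : Fin n → ℝ, IsSecondEigenvector A' v → SignsRecover c v (ε * n)}
              ≥ ENNReal.ofReal (1 - Real.exp (-r)) := by
  intro ε r hε hr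
  have hε' : 0 < min ε 1 := lt_min hε one_pos
  have hρ : 0 ≤ r + 2 := by linarith
  have hD : 0 ≤ deviationConstant (r + 2) := by unfold deviationConstant; positivity
  refine ⟨(25 * deviationConstant (r + 2) / min ε 1) ^ 2 + 1, by positivity, ?_⟩
  intro n a b c hc hb hba han hgap Ω _ μ _ G hG
  obtain ⟨ha, hβ⟩ := gap_bounds hD hε' hb hba hgap
  have hn : 0 < n := by exact_mod_cast (zero_lt_one.trans_le ha).trans_le han
  have : NeZero n := ⟨hn.ne'⟩
  obtain ⟨L, hL, hL'⟩ := exists_nat_pow_near (Real.one_le_sqrt.2 ha) one_lt_two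
  have htypical := hG.hasIndependentEdges.measureReal_not_isTypicalSample_le
    (hG.edgeProbability_le (by positivity) (by gcongr)) hn (zero_lt_one.trans_le ha) hρ L
  have hrecover : ∀ ω, IsTypicalSample (adjacency (G ω)) (edgeProbability μ G) a (r + 2) L →
      ∀ A', IsDegreeRegularization (adjacency (G ω)) (2 * a) A' →
        ∀ v, IsSecondEigenvector A' v → SignsRecover c v (ε * n) := fun ω hω A' hA' v hv =>
    (hv.signsRecover hc hε' (min_le_right _ _) hb hba hβ hA'.nonneg
      (hG.norm_toEuclideanCLM_sub_blockMatrix_le hb hba.le ha han hρ hL hL'.le hω hA')).mono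
      (by gcongr; exact min_le_left _ _)
  rw [ge_iff_le, ENNReal.ofReal_le_iff_le_toReal (measure_ne_top _ _)]
  calc 1 - exp (-r)
      ≤ 1 - μ.real {ω | ¬IsTypicalSample (adjacency (G ω)) (edgeProbability μ G) a (r + 2) L} :=
        sub_le_sub_left (htypical.trans (six_mul_exp_neg_add_two_le r)) 1
    _ ≤ μ.real {ω | IsTypicalSample (adjacency (G ω)) (edgeProbability μ G) a (r + 2) L} :=
        one_sub_measureReal_compl_le _
    _ ≤ _ := measureReal_mono hrecover
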